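/- Let $\zeta,\phi_1,\phi_2,X,Y$ be independent, where $\zeta$ is Gamma distributed with density $m^m u^{m-1}e^{-mu}/\Gamma(m)$, $u>0$ (real $m>0$), $\phi_1,\phi_2$ are uniform on $[0,2\pi)$, and $X,Y\sim\mathcal N(0,\sigma^2)$ with $\sigma>0$. For constants $V_1,V_2\ge 0$ put $$V=\sqrt{\zeta}\,V_1e^{j\phi_1}+\sqrt{\zeta}\,V_2e^{j\phi_2}+X+jY,\qquad K=\frac{V_1^2+V_2^2}{2\sigma^2},\qquad \Delta=\frac{2V_1V_2}{V_1^2+V_2^2}\in[0,1]$$ (if $V_1=V_2=0$, any $\Delta\in[0,1]$ is allowed). A random variable $\gamma$ with the law of $|V|^2$ and mean $\bar\gamma=\mathbb E|V|^2$ is said to have the fluctuating two-ray distribution, $\gamma\sim\mathcal{FTR}(\bar\gamma,m,K,\Delta)$. Let $\gamma\sim\mathcal{FTR}(\bar\gamma,m,K,\Delta)$, let $n\ge 0$ be an integer and let $s\in\mathbb C$ satisfy $(m+K+K\Delta)\,\bar\gamma\,\operatorname{Re}s<m(1+K)$ (in particular, $s$ may be any non-positive real number). Then $\gamma^ne^{s\gamma}$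 is integrable, and the generalized moment generating function $M_\gamma^{(n)}(s)=\mathbb E[\gamma^ne^{s\gamma}]$ is $$M_\gamma^{(n)}(s)=n!\,m^m(1+K-\bar\gamma s)^{m-n-1}\,\bar\gamma^{\,n}\sum_{l=0}^n\binom nl\frac{(m)_l}{l!}\,\frac{(1+K)^{l+1}K^l}{\left[m(1+K)-(m+K-K\Delta)\bar\gamma s\right]^{m+l}}$$ $$\times\sum_{q=0}^l\binom lq(1-\Delta)^{l-q}(2\Delta)^q\,\frac{\Gamma(\frac12+q)}{\sqrt\pi\,\Gamma(q+1)}\;{}_2F_1\!\left(m+l,\tfrac12+q;q+1;\frac{2K\Delta\bar\gamma s}{m(1+K)-(m+K-K\Delta)\bar\gamma s}\right),$$ where $(m)_l=m(m+1)\cdots(m+l-1)$, $0^0=1$, powers are principal values, and ${}_2F_1$ is the Gauss hypergeometric function on $\mathbb C\setminus[1,\infty)$, that is, the analytic continuation of the hypergeometric series from the unit disc. -/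

import Mathlib

open MeasureTheory ProbabilityTheory

/-! ### The Gauss hypergeometric function on the plane cut along `[1, ∞)` -/

/-- `F` is the analytic continuation of the Gauss hypergeometric series
`∑ (a)ₖ (b)ₖ / ((c)ₖ k!) zᵏ` from the open unit disc to the cut plane `ℂ \ [1, ∞)`. -/
def IsGaussHypergeometric (a b c : ℂ) (F : ℂ → ℂ) : Prop :=
  DifferentiableOn ℂ F {z : ℂ | 1 - z ∈ Complex.slitPlane} ∧
    ∀ z : ℂ, ‖z‖ < 1 → F z = ordinaryHypergeometric a b c z

open Classical in
/-- The Gauss hypergeometric function `₂F₁(a, b; c; z)` (principal branch): the sum of the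
hypergeometric series for `‖z‖ < 1`, and its analytic continuation elsewhere in `ℂ \ [1, ∞)`.
(Mathlib's `ordinaryHypergeometric` is only the sum of the series.) -/
noncomputable def gaussHypergeometric (a b c z : ℂ) : ℂ :=
  if h : ∃ F : ℂ → ℂ, IsGaussHypergeometric a b c F then h.choose z else 0

/-- The continuation is unique, so the choice in `gaussHypergeometric` is immaterial. -/
theorem gaussHypergeometric_eq {a b c : ℂ} {F : ℂ → ℂ} (hF : IsGaussHypergeometric a b c F)
    {z : ℂ} (hz : 1 - z ∈ Complex.slitPlane) : gaussHypergeometric a b c z = F z := by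
  have h : ∃ F : ℂ → ℂ, IsGaussHypergeometric a b c F := ⟨F, hF⟩
  have hG := h.choose_spec
  rw [gaussHypergeometric, dif_pos h]
  have hopen : IsOpen {z : ℂ | 1 - z ∈ Complex.slitPlane} :=
    Complex.isOpen_slitPlane.preimage (continuous_const.sub continuous_id)
  have hconn : IsPreconnected {z : ℂ | 1 - z ∈ Complex.slitPlane} := by
    have h1 : IsPreconnected Complex.slitPlane :=
      (Complex.starConvex_one_slitPlane.isPathConnected Complex.one_mem_slitPlane).isConnected.isPreconnected
    have h2 := h1.image (fun w : ℂ => 1 - w) (by fun_prop)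
    convert h2 using 1
    ext w
    simp only [Set.mem_ofPred_eq, Set.mem_image]
    exact ⟨fun hw => ⟨1 - w, hw, by ring⟩, fun ⟨v, hv, hvw⟩ => by rw [← hvw]; simpa using hv⟩
  have h0 : (0 : ℂ) ∈ {z : ℂ | 1 - z ∈ Complex.slitPlane} := by simp
  refine (hG.1.analyticOnNhd hopen).eqOn_of_preconnected_of_eventuallyEq
    (hF.1.analyticOnNhd hopen) hconn h0 ?_ hz
  filter_upwards [Metric.ball_mem_nhds (0 : ℂ) one_pos] with w hw
  have hw' : ‖w‖ < 1 := by simpa using hw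
  rw [hG.2 w hw', hF.2 w hw']

/-! ### The fluctuating two-ray (FTR) distribution -/

/-- The received complex baseband signal
`√ζ V₁ exp(j φ₁) + √ζ V₂ exp(j φ₂) + X + j Y` of the two-ray channel. -/
noncomputable def receivedSignal (V₁ V₂ ζ φ₁ φ₂ X Y : ℝ) : ℂ :=
  (Real.sqrt ζ : ℂ) * V₁ * Complex.exp (Complex.I * φ₁)
    + (Real.sqrt ζ : ℂ) * V₂ * Complex.exp (Complex.I * φ₂) + (X + Complex.I * Y)

/-- The uniform distribution on `[0, 2π)`. -/
noncomputable def uniformPhase : Measure ℝ :=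
  cond volume (Set.Ico 0 (2 * Real.pi))

/-- The law of `|V|²`, where `V = √ζ V₁ exp(j φ₁) + √ζ V₂ exp(j φ₂) + X + j Y` and
`ζ, φ₁, φ₂, X, Y` are independent: `ζ` has the unit-mean Gamma law with density
`mᵐ uᵐ⁻¹ e^{-mu} / Γ(m)`, the phases `φ₁, φ₂` are uniform on `[0, 2π)`, and
`X, Y` are centred Gaussian of variance `σ²`. -/
noncomputable def envelopePowerLaw (m V₁ V₂ σ : ℝ) : Measure ℝ :=
  ((gammaMeasure m m).prod (uniformPhase.prod (uniformPhase.prod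
    ((gaussianReal 0 (σ ^ 2).toNNReal).prod (gaussianReal 0 (σ ^ 2).toNNReal))))).map
    (fun p : ℝ × ℝ × ℝ × ℝ × ℝ =>
      ‖receivedSignal V₁ V₂ p.1 p.2.1 p.2.2.1 p.2.2.2.1 p.2.2.2.2‖ ^ 2)

/-- `γ ∼ FTR(γbar, m, K, Δ)`: `γ` is distributed as the envelope power `|V|²` of a two-ray channel
with amplitudes `V₁, V₂ ≥ 0`, diffuse power `2σ² > 0` and Gamma shape `m > 0`, where
`K = (V₁² + V₂²) / (2σ²)`, `Δ = 2 V₁ V₂ / (V₁² + V₂²)`, and `γbar` is the mean.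
If `V₁ = V₂ = 0` (that is, `K = 0`) the quotient is undefined and any `Δ ∈ [0, 1]` is allowed. -/
def IsFTR {Ω : Type*} [MeasurableSpace Ω] (γ : Ω → ℝ) (γbar m K Δ : ℝ) (P : Measure Ω) : Prop :=
  0 < m ∧ 0 ≤ Δ ∧ Δ ≤ 1 ∧
    ∃ V₁ V₂ σ : ℝ, 0 ≤ V₁ ∧ 0 ≤ V₂ ∧ 0 < σ ∧
      K = (V₁ ^ 2 + V₂ ^ 2) / (2 * σ ^ 2) ∧
      Δ * (V₁ ^ 2 + V₂ ^ 2) = 2 * V₁ * V₂ ∧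
      γbar = ∫ x, x ∂(envelopePowerLaw m V₁ V₂ σ) ∧
      HasLaw γ (envelopePowerLaw m V₁ V₂ σ) P

/-- The generalized moment generating function `M⁽ⁿ⁾(s) = E[γⁿ e^{sγ}]`. -/
noncomputable def gmgf {Ω : Type*} [MeasurableSpace Ω] (γ : Ω → ℝ) (P : Measure Ω) (n : ℕ)
    (s : ℂ) : ℂ :=
  ∫ ω, (γ ω : ℂ) ^ n * Complex.exp (s * γ ω) ∂P

/-! Put `w = 2σ²`, `u = (1 - w s)⁻¹` and `c = 1 + Δ cos(φ₁ - φ₂)`. Given `ζ` and the phases, `|V|²`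
is the squared norm of a planar Gaussian with offset power `w ζ K c`. Its exponential moment is `u
exp(ζ K c (u - 1))`, and `n` derivatives in `s` bring in a Laguerre polynomial in `ζ K c u`
(`integral_pow_mul_cexp_sq_add_sq_gaussian`).

Averaging `ζˡ exp(κ ζ)` over the Gamma law, with `κ = K c (u - 1)`, gives `mᵐ (m)ₗ (m - κ)^(-(m+l))`
(`integral_pow_mul_cexp_gammaMeasure`). The phases enter only through `c = 1 - Δ + 2Δ sin² θ` with
`θ` uniform on `[0, π]`. Expanding `cˡ` binomially and factoring `m - κ` as a constant times `1 - z
sin² θ` leaves Euler integrals (`integral_specular_average`). These are analytic on the cut plane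
and agree with the hypergeometric series in the disc, so they are `₂F₁`
(`isGaussHypergeometric_eulerIntegral`).

The condition on `Re s` keeps `Re κ` below `m` uniformly in the phases
(`exists_bound_re_mul_inv_sub_one`); this gives integrability and justifies every exchange. -/

/-! ### Euler's integral and the continuation of `₂F₁` -/

/-- The slit plane is star-shaped about `1`, and `1 - z t` lies on the segment from `1` to `1 - z`.
-/
theorem one_sub_mul_mem_slitPlane {z : ℂ} (hz : 1 - z ∈ Complex.slitPlane) {t : ℝ}
    (h0 : 0 ≤ t) (h1 : t ≤ 1) : 1 - z * t ∈ Complex.slitPlane := by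
  rw [Complex.mem_slitPlane_iff] at hz ⊢
  simp only [Complex.sub_re, Complex.one_re, Complex.sub_im, Complex.one_im, Complex.mul_re,
    Complex.mul_im, Complex.ofReal_re, Complex.ofReal_im, mul_zero, sub_zero, zero_add,
    zero_sub] at hz ⊢
  rcases h0.eq_or_lt with rfl | ht
  · left; simp
  rcases hz with h | h
  · left; nlinarith
  · right; simp at h ⊢; exact ⟨h, ht.ne'⟩

theorem hasSum_one_sub_cpow_neg (a : ℂ) {x : ℂ} (hx : ‖x‖ < 1) :
    HasSum (fun k : ℕ => (ascPochhammer ℂ k).eval a / (k.factorial : ℂ) * x ^ k)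
      ((1 - x) ^ (-a)) := by
  have h := Complex.one_add_cpow_hasFPowerSeriesOnBall_zero (a := -a)
  -- The parameter `b` occurs above and below and cancels; `b = 1` makes its Pochhammer symbol `k!`,
  -- which never vanishes.
  rw [binomialSeries_eq_ordinaryHypergeometricSeries (b := (1 : ℂ))
    (fun k hk => by
      have := congrArg Complex.re hk
      simp at this
      have h2 : (0 : ℝ) ≤ k := k.cast_nonneg
      linarith)] at h
  have h2 := h.hasSum (y := -x) (by simpa [← ofReal_norm] using hx)
  simp only [zero_add] at h2
  convert! h2 using 1
  funext k
  have h3 : (ascPochhammer ℂ k).eval 1 ≠ 0 := by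
    rw [ascPochhammer_eval_one]; exact_mod_cast k.factorial_ne_zero
  simp [ordinaryHypergeometricSeries, FormalMultilinearSeries.compContinuousLinearMap,
    FormalMultilinearSeries.ofScalars]
  left
  field_simp

/-- The moments of `sin ^ 2`, normalised. -/
noncomputable def wallisRatio (n : ℕ) : ℝ :=
  ∏ i ∈ Finset.range n, (2 * (i : ℝ) + 1) / (2 * i + 2)

theorem wallisRatio_pos (n : ℕ) : 0 < wallisRatio n :=
  Finset.prod_pos fun i _ => by positivity

theorem wallisRatio_eq_Gamma (q : ℕ) :
    Real.Gamma (1 / 2 + q) / (Real.sqrt Real.pi * Real.Gamma (q + 1)) = wallisRatio q := by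
  have hpi : Real.sqrt Real.pi ≠ 0 := by positivity
  induction q with
  | zero => simpa [wallisRatio] using div_eq_one_iff_eq hpi |>.2 Real.Gamma_one_half_eq
  | succ k ih =>
    rw [wallisRatio, Finset.prod_range_succ, ← wallisRatio, ← ih]
    have h1 : Real.Gamma (k + 1) ≠ 0 := (Real.Gamma_pos_of_pos (by positivity)).ne'
    push_cast
    rw [Real.Gamma_add_one (by positivity : (k + 1 : ℝ) ≠ 0), ← add_assoc,
      Real.Gamma_add_one (by positivity : (1 / 2 + k : ℝ) ≠ 0)]
    field_simp
    ring

/-- With `wallisRatio q = (1/2)_q / q!`, shifting by `k` produces exactly the Pochhammer quotient in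
the coefficients of `₂F₁(a, 1/2 + q; q + 1; ·)`. -/
theorem wallisRatio_add (q k : ℕ) :
    ((wallisRatio (q + k) : ℝ) : ℂ) = (wallisRatio q : ℂ) *
      ((ascPochhammer ℂ k).eval (1 / 2 + q : ℂ) / (ascPochhammer ℂ k).eval (q + 1 : ℂ)) := by
  induction k with
  | zero => simp
  | succ k ih =>
    have h1 : (q + 1 + k : ℂ) ≠ 0 := by exact_mod_cast (by omega : q + 1 + k ≠ 0)
    rw [ascPochhammer_succ_eval, ascPochhammer_succ_eval, ← add_assoc, wallisRatio,
      Finset.prod_range_succ, ← wallisRatio]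
    push_cast
    rw [ih]
    have h2 : (2 * (q + k) + 2 : ℂ) ≠ 0 := by
      rw [show (2 * (q + k) + 2 : ℂ) = 2 * (q + 1 + k) by ring]
      exact mul_ne_zero two_ne_zero h1
    have h3 : (ascPochhammer ℂ k).eval (q + 1 : ℂ) ≠ 0 := by
      have : (ascPochhammer ℂ k).eval (q + 1 : ℂ) = (((ascPochhammer ℕ k).eval (q + 1) : ℕ) : ℂ) := by
        simp
      rw [this]
      exact_mod_cast (ascPochhammer_pos k (q + 1) (by omega)).ne'
    rw [show (2 * (q + k) + 2 : ℂ) = 2 * (q + 1 + k) by ring]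
    field_simp
    ring

theorem integral_sin_sq_pow (n : ℕ) :
    ∫ θ in (0 : ℝ)..Real.pi, (Real.sin θ ^ 2) ^ n = Real.pi * wallisRatio n := by
  simp_rw [← pow_mul]
  exact integral_sin_pow_even n

/-- Euler's integral `∫ tᵠ (1 - z t)⁻ᵃ` over the arcsine law, in the variable `t = sin² θ`. -/
noncomputable def eulerIntegral (a : ℂ) (q : ℕ) (z : ℂ) : ℂ :=
  ∫ θ in (0 : ℝ)..Real.pi,
    ((Real.sin θ ^ 2 : ℝ) : ℂ) ^ q * (1 - z * ((Real.sin θ ^ 2 : ℝ) : ℂ)) ^ (-a)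

theorem continuousOn_eulerIntegrand (a : ℂ) (q : ℕ) :
    ContinuousOn (fun p : ℂ × ℝ => ((Real.sin p.2 ^ 2 : ℝ) : ℂ) ^ q
      * (1 - p.1 * ((Real.sin p.2 ^ 2 : ℝ) : ℂ)) ^ (-a))
      ({z : ℂ | 1 - z ∈ Complex.slitPlane} ×ˢ Set.univ) := by
  refine ContinuousOn.mul (by fun_prop) (ContinuousOn.cpow (by fun_prop) continuousOn_const ?_)
  rintro ⟨z, θ⟩ ⟨hz, -⟩
  exact one_sub_mul_mem_slitPlane hz (sq_nonneg _) (Real.sin_sq_le_one _)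

theorem continuous_eulerIntegrand (a : ℂ) (q : ℕ) {z : ℂ} (hz : 1 - z ∈ Complex.slitPlane) :
    Continuous (fun θ : ℝ => ((Real.sin θ ^ 2 : ℝ) : ℂ) ^ q
      * (1 - z * ((Real.sin θ ^ 2 : ℝ) : ℂ)) ^ (-a)) :=
  (continuousOn_eulerIntegrand a q).comp_continuous (f := fun θ : ℝ => (z, θ)) (by fun_prop)
    fun θ => ⟨hz, trivial⟩

/-- Differentiating the integrand in `z` gives `a` times the integrand with `a` and `q` raised by
one, which is bounded on a compact ball times `[0, π]`. -/
theorem differentiableOn_eulerIntegral (a : ℂ) (q : ℕ) :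
    DifferentiableOn ℂ (eulerIntegral a q) {z : ℂ | 1 - z ∈ Complex.slitPlane} := by
  intro z hz
  have hopen : IsOpen {z : ℂ | 1 - z ∈ Complex.slitPlane} :=
    Complex.isOpen_slitPlane.preimage (continuous_const.sub continuous_id)
  obtain ⟨ε, hε, hball⟩ := Metric.nhds_basis_closedBall.mem_iff.1 (hopen.mem_nhds hz)
  have hK : IsCompact (Metric.closedBall z ε ×ˢ Set.Icc (0 : ℝ) Real.pi) :=
    (isCompact_closedBall z ε).prod isCompact_Icc
  obtain ⟨C, hC⟩ := hK.exists_bound_of_continuousOn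
    (((continuousOn_eulerIntegrand (a + 1) (q + 1)).mono
      (Set.prod_mono hball (Set.subset_univ _))).const_mul a)
  have h := intervalIntegral.hasDerivAt_integral_of_dominated_loc_of_deriv_le
    (μ := volume) (a := 0) (b := Real.pi) (bound := fun _ => C)
    (F := fun z θ => ((Real.sin θ ^ 2 : ℝ) : ℂ) ^ q
      * (1 - z * ((Real.sin θ ^ 2 : ℝ) : ℂ)) ^ (-a))
    (F' := fun z θ => a * (((Real.sin θ ^ 2 : ℝ) : ℂ) ^ (q + 1)
      * (1 - z * ((Real.sin θ ^ 2 : ℝ) : ℂ)) ^ (-(a + 1))))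
    (Metric.closedBall_mem_nhds z hε) ?_ ?_ ?_ ?_ ?_ ?_
  · exact h.2.differentiableAt.differentiableWithinAt
  · filter_upwards [hopen.mem_nhds hz] with w hw
    exact (continuous_eulerIntegrand a q hw).aestronglyMeasurable
  · exact (continuous_eulerIntegrand a q hz).intervalIntegrable _ _
  · exact ((continuous_eulerIntegrand (a + 1) (q + 1) hz).const_smul a).aestronglyMeasurable
  · refine Filter.Eventually.of_forall fun θ hθ w hw => hC (w, θ) ⟨hw, ?_⟩
    rw [Set.uIoc_of_le Real.pi_pos.le] at hθ
    exact ⟨hθ.1.le, hθ.2⟩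
  · exact intervalIntegrable_const
  · refine Filter.Eventually.of_forall fun θ _ w hw => ?_
    have hs := one_sub_mul_mem_slitPlane (hball hw) (sq_nonneg (Real.sin θ)) (Real.sin_sq_le_one _)
    have h1 : HasDerivAt (fun w : ℂ => 1 - w * ((Real.sin θ ^ 2 : ℝ) : ℂ))
        (-((Real.sin θ ^ 2 : ℝ) : ℂ)) w := by
      simpa only [id, one_mul] using
        ((hasDerivAt_id w).mul_const ((Real.sin θ ^ 2 : ℝ) : ℂ)).const_sub 1
    convert! (h1.cpow_const (c := -a) hs).const_mul (((Real.sin θ ^ 2 : ℝ) : ℂ) ^ q) using 1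
    rw [show -(a + 1) = -a - 1 by ring]
    ring

theorem hasSum_eulerIntegral (a : ℂ) (q : ℕ) {z : ℂ} (hz : ‖z‖ < 1) :
    HasSum (fun k : ℕ => (ascPochhammer ℂ k).eval a / (k.factorial : ℂ) * z ^ k
      * (Real.pi * wallisRatio (q + k) : ℝ)) (eulerIntegral a q z) := by
  -- Since `sin² ≤ 1`, the binomial series at the real point `‖z‖` dominates uniformly in `θ`.
  have hb : Summable fun k : ℕ => ‖(ascPochhammer ℂ k).eval a / (k.factorial : ℂ) * (‖z‖ : ℂ) ^ k‖ :=
    (hasSum_one_sub_cpow_neg a (x := (‖z‖ : ℂ)) (by simpa using hz)).summable.norm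
  have h := intervalIntegral.hasSum_integral_of_dominated_convergence (μ := volume)
    (a := 0) (b := Real.pi)
    (F := fun (k : ℕ) (θ : ℝ) => (ascPochhammer ℂ k).eval a / (k.factorial : ℂ) * z ^ k *
      (((Real.sin θ ^ 2) ^ (q + k) : ℝ) : ℂ))
    (f := fun θ => ((Real.sin θ ^ 2 : ℝ) : ℂ) ^ q * (1 - z * ((Real.sin θ ^ 2 : ℝ) : ℂ)) ^ (-a))
    (fun k _ => ‖(ascPochhammer ℂ k).eval a / (k.factorial : ℂ) * (‖z‖ : ℂ) ^ k‖)
    ?_ ?_ ?_ ?_ ?_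
  · convert! h using 1
    funext k
    rw [intervalIntegral.integral_const_mul, intervalIntegral.integral_ofReal, integral_sin_sq_pow]
  · intro k
    refine Continuous.aestronglyMeasurable ?_
    fun_prop
  · refine fun k => Filter.Eventually.of_forall fun θ _ => ?_
    have h1 : (Real.sin θ ^ 2) ^ (q + k) ≤ 1 := pow_le_one₀ (sq_nonneg _) (Real.sin_sq_le_one θ)
    rw [norm_mul, Complex.norm_real, Real.norm_of_nonneg (by positivity)]
    refine (mul_le_of_le_one_right (norm_nonneg _) h1).trans (le_of_eq ?_)
    simp
  · exact Filter.Eventually.of_forall fun _ _ => hb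
  · exact intervalIntegrable_const
  · refine Filter.Eventually.of_forall fun θ _ => ?_
    have h1 : ‖z * ((Real.sin θ ^ 2 : ℝ) : ℂ)‖ < 1 := by
      rw [norm_mul, Complex.norm_real, Real.norm_of_nonneg (sq_nonneg _)]
      exact (mul_le_of_le_one_right (norm_nonneg _) (Real.sin_sq_le_one θ)).trans_lt hz
    convert! (hasSum_one_sub_cpow_neg a h1).mul_left (((Real.sin θ ^ 2 : ℝ) : ℂ) ^ q) using 1
    funext k
    push_cast
    ring

theorem isGaussHypergeometric_eulerIntegral (a : ℂ) (q : ℕ) :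
    IsGaussHypergeometric a (1 / 2 + q) (q + 1)
      (fun z => (Real.pi * wallisRatio q : ℂ)⁻¹ * eulerIntegral a q z) := by
  refine ⟨(differentiableOn_eulerIntegral a q).const_mul _, fun z hz => ?_⟩
  beta_reduce
  rw [ordinaryHypergeometric_eq_tsum, ← ((hasSum_eulerIntegral a q hz).mul_left _).tsum_eq]
  refine tsum_congr fun k => ?_
  have h1 : (wallisRatio q : ℂ) ≠ 0 := by exact_mod_cast (wallisRatio_pos q).ne'
  have h2 : (Real.pi : ℂ) ≠ 0 := by exact_mod_cast Real.pi_ne_zero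
  rw [Complex.ofReal_mul, wallisRatio_add, smul_eq_mul, div_eq_mul_inv _ (Polynomial.eval _ _)]
  field_simp

/-- The Gamma quotient in the final formula is the value of the normalised Euler integral at `z =
0`, so it cancels the normalisation of `₂F₁`. -/
theorem wallisRatio_mul_gaussHypergeometric (a : ℂ) (q : ℕ) {z : ℂ}
    (hz : 1 - z ∈ Complex.slitPlane) :
    (wallisRatio q : ℂ) * gaussHypergeometric a (1 / 2 + q) (q + 1) z
      = (Real.pi : ℂ)⁻¹ * eulerIntegral a q z := by
  have h1 : (wallisRatio q : ℂ) ≠ 0 := by exact_mod_cast (wallisRatio_pos q).ne'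
  have h2 : (Real.pi : ℂ) ≠ 0 := by exact_mod_cast Real.pi_ne_zero
  rw [gaussHypergeometric_eq (isGaussHypergeometric_eulerIntegral a q) hz]
  field_simp

/-! ### Gaussian average over the diffuse component -/

/-- The prefactor `A` is a square root whose branch is irrelevant: `X` and `Y` each contribute it
once, so only `A * A` is needed. -/
theorem exists_integral_cexp_mul_add_sq_gaussianReal {v : NNReal} (hv : v ≠ 0) {s : ℂ}
    (hs : 2 * v * s.re < 1) :
    ∃ A : ℂ, A * A = (1 - 2 * v * s)⁻¹ ∧ ∀ a : ℝ,
      ∫ x, Complex.exp (s * ((a + x : ℝ) : ℂ) ^ 2) ∂(gaussianReal 0 v)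
        = A * Complex.exp (a ^ 2 * s / (1 - 2 * v * s)) := by
  have hv0 : (0 : ℝ) < v := by positivity
  have hvC : (v : ℂ) ≠ 0 := by exact_mod_cast hv0.ne'
  have hre : 0 < (1 - 2 * v * s : ℂ).re := by
    have : (1 - 2 * v * s : ℂ).re = 1 - 2 * v * s.re := by simp
    rw [this]; linarith
  have hne : (1 - 2 * v * s : ℂ) ≠ 0 := fun h => by simp [h] at hre
  have hb : (-((1 - 2 * v * s) / (2 * v)) : ℂ).re < 0 := by
    have : (-((1 - 2 * v * s) / (2 * v)) : ℂ) = ((-(1 / (2 * v)) : ℝ) : ℂ) * (1 - 2 * v * s) := by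
      push_cast; ring
    rw [this, Complex.re_ofReal_mul]
    exact mul_neg_of_neg_of_pos (by simpa using hv0) hre
  have hpi : (0 : ℝ) < 2 * Real.pi * v := by positivity
  refine ⟨(Real.sqrt (2 * Real.pi * v) : ℂ)⁻¹ *
    (Real.pi / -(-((1 - 2 * v * s) / (2 * v))) : ℂ) ^ (1 / 2 : ℂ), ?_, fun a => ?_⟩
  · have h1 : (Real.sqrt (2 * Real.pi * v) : ℂ) * Real.sqrt (2 * Real.pi * v) = 2 * Real.pi * v := by
      rw [← Complex.ofReal_mul, Real.mul_self_sqrt hpi.le]; push_cast; rfl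
    have h2 : ∀ z : ℂ, z ≠ 0 → z ^ (1 / 2 : ℂ) * z ^ (1 / 2 : ℂ) = z := fun z hz => by
      rw [← Complex.cpow_add _ _ hz]; norm_num
    rw [mul_mul_mul_comm, ← mul_inv, h1, h2]
    · rw [neg_neg]
      have : (Real.pi : ℂ) ≠ 0 := by exact_mod_cast Real.pi_ne_zero
      field_simp
    · rw [neg_neg]
      have : (Real.pi : ℂ) ≠ 0 := by exact_mod_cast Real.pi_ne_zero
      exact div_ne_zero this (div_ne_zero hne (by simpa using hvC))
  · rw [integral_gaussianReal_eq_integral_smul hv, mul_assoc]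
    have := integral_cexp_quadratic hb (2 * s * a) (s * a ^ 2)
    have h3 : (s * a ^ 2 - (2 * s * a) ^ 2 / (4 * (-((1 - 2 * v * s) / (2 * v)))) : ℂ)
        = a ^ 2 * s / (1 - 2 * v * s) := by
      generalize hD : (1 - 2 * v * s : ℂ) = D at hne
      have : s = (1 - D) / (2 * v) := by rw [← hD]; field_simp; ring
      rw [this]
      field_simp
      ring
    rw [h3] at this
    rw [← this, ← integral_const_mul]
    refine integral_congr_ae (Filter.Eventually.of_forall fun x => ?_)
    simp only [gaussianPDFReal, sub_zero, Complex.real_smul]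
    push_cast
    rw [mul_assoc, ← Complex.exp_add]
    congr 2
    field_simp
    ring

theorem integral_cexp_mul_sq_add_sq_gaussian {v : NNReal} (hv : v ≠ 0) {s : ℂ}
    (hs : 2 * v * s.re < 1) (a b : ℝ) :
    ∫ p : ℝ × ℝ, Complex.exp (s * (((a + p.1) ^ 2 + (b + p.2) ^ 2 : ℝ) : ℂ))
        ∂((gaussianReal 0 v).prod (gaussianReal 0 v))
      = (1 - 2 * v * s)⁻¹ * Complex.exp ((a ^ 2 + b ^ 2 : ℝ) * s / (1 - 2 * v * s)) := by
  obtain ⟨A, hA, h⟩ := exists_integral_cexp_mul_add_sq_gaussianReal hv hs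
  have : ∀ p : ℝ × ℝ, Complex.exp (s * (((a + p.1) ^ 2 + (b + p.2) ^ 2 : ℝ) : ℂ))
      = Complex.exp (s * ((a + p.1 : ℝ) : ℂ) ^ 2) * Complex.exp (s * ((b + p.2 : ℝ) : ℂ) ^ 2) :=
    fun p => by rw [← Complex.exp_add]; congr 1; push_cast; ring
  simp_rw [this]
  rw [integral_prod_mul (fun x : ℝ => Complex.exp (s * ((a + x : ℝ) : ℂ) ^ 2))
    (fun y : ℝ => Complex.exp (s * ((b + y : ℝ) : ℂ) ^ 2)), h a, h b, mul_mul_mul_comm, hA,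
    ← Complex.exp_add]
  congr 2
  push_cast
  ring

theorem integral_exp_mul_sq_add_sq_gaussian {v : NNReal} (hv : v ≠ 0) {r : ℝ}
    (hr : 2 * v * r < 1) (a b : ℝ) :
    Integrable (fun p : ℝ × ℝ => Real.exp (r * ((a + p.1) ^ 2 + (b + p.2) ^ 2)))
        ((gaussianReal 0 v).prod (gaussianReal 0 v)) ∧
    ∫ p : ℝ × ℝ, Real.exp (r * ((a + p.1) ^ 2 + (b + p.2) ^ 2))
        ∂((gaussianReal 0 v).prod (gaussianReal 0 v))
      = (1 - 2 * v * r)⁻¹ * Real.exp ((a ^ 2 + b ^ 2) * r / (1 - 2 * v * r)) := by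
  have h : ∫ p : ℝ × ℝ, Real.exp (r * ((a + p.1) ^ 2 + (b + p.2) ^ 2))
        ∂((gaussianReal 0 v).prod (gaussianReal 0 v))
      = (1 - 2 * v * r)⁻¹ * Real.exp ((a ^ 2 + b ^ 2) * r / (1 - 2 * v * r)) := by
    have := integral_cexp_mul_sq_add_sq_gaussian hv (s := (r : ℂ)) (by simpa using hr) a b
    rw [← Complex.ofReal_inj, ← integral_complex_ofReal]
    push_cast at this ⊢
    exact this
  -- The integral of a non-integrable function is `0` by convention, so a positive value proves
  -- integrability.
  refine ⟨Integrable.of_integral_ne_zero ?_, h⟩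
  rw [h]
  have : 0 < 1 - 2 * v * r := by linarith
  positivity

/-- The Laguerre polynomial `Lₙ` at `-y`. -/
noncomputable def laguerreNeg (n : ℕ) (y : ℂ) : ℂ :=
  ∑ l ∈ Finset.range (n + 1), (n.choose l : ℂ) / (l.factorial : ℂ) * y ^ l

theorem hasDerivAt_laguerreNeg (n : ℕ) (y : ℂ) :
    HasDerivAt (laguerreNeg n) (∑ l ∈ Finset.range (n + 1),
      (n.choose l : ℂ) / (l.factorial : ℂ) * (l * y ^ (l - 1))) y := by
  unfold laguerreNeg
  exact HasDerivAt.fun_sum fun l _ => (hasDerivAt_pow l y).const_mul _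

/-- This is `(n+1) Lₙ₊₁ = (n+1+y) Lₙ + y Lₙ'` for `Lₙ = laguerreNeg n`, the recurrence needed when
the Gaussian moment formula is differentiated in `s`. It follows by comparing coefficients. -/
theorem laguerreNeg_succ (n : ℕ) (y : ℂ) :
    (n + 1) * laguerreNeg (n + 1) y = (n + 1) * laguerreNeg n y + y * laguerreNeg n y +
      y * ∑ l ∈ Finset.range (n + 1),
        (n.choose l : ℂ) / (l.factorial : ℂ) * (l * y ^ (l - 1)) := by
  have e1 : laguerreNeg n y =
      ∑ l ∈ Finset.range (n + 1 + 1), (n.choose l : ℂ) / (l.factorial : ℂ) * y ^ l := by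
    rw [Finset.sum_range_succ, Nat.choose_succ_self]; simp [laguerreNeg]
  -- At `l = 0` the factor `l` kills the term, so the truncated `l - 1` is harmless.
  have e2 : y * laguerreNeg n y = ∑ l ∈ Finset.range (n + 1 + 1),
      (l * n.choose (l - 1) : ℂ) / (l.factorial : ℂ) * y ^ l := by
    rw [Finset.sum_range_succ', laguerreNeg, Finset.mul_sum]
    simp only [Nat.cast_zero, zero_mul, zero_div, add_zero]
    refine Finset.sum_congr rfl fun l _ => ?_
    have : (l + 1 : ℂ) ≠ 0 := by exact_mod_cast l.succ_ne_zero
    have h2 : (l.factorial : ℂ) ≠ 0 := by exact_mod_cast l.factorial_ne_zero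
    rw [Nat.factorial_succ, Nat.add_sub_cancel]
    push_cast
    field_simp
    ring
  have e3 : y * ∑ l ∈ Finset.range (n + 1), (n.choose l : ℂ) / (l.factorial : ℂ) * (l * y ^ (l - 1))
      = ∑ l ∈ Finset.range (n + 1 + 1), (l * n.choose l : ℂ) / (l.factorial : ℂ) * y ^ l := by
    rw [Finset.sum_range_succ _ (n + 1), Nat.choose_succ_self, Finset.mul_sum]
    simp only [Nat.cast_zero, zero_mul, zero_div, add_zero, mul_zero]
    refine Finset.sum_congr rfl fun l _ => ?_
    rcases l with _ | l
    · simp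
    · rw [Nat.add_sub_cancel]; ring
  rw [e3, e2, e1, laguerreNeg, Finset.mul_sum, Finset.mul_sum, ← Finset.sum_add_distrib,
    ← Finset.sum_add_distrib]
  refine Finset.sum_congr rfl fun l _ => ?_
  rcases l with _ | l
  · simp
  · have h1 : (((n + 1).choose (l + 1) : ℕ) : ℂ) = n.choose l + n.choose (l + 1) := by
      exact_mod_cast congrArg (Nat.cast (R := ℂ)) (Nat.choose_succ_succ n l)
    have h2 : ((l : ℂ) + 1) * n.choose (l + 1) = (n - l) * n.choose l := by
      rcases le_or_gt l n with h | h
      · have := congrArg (Nat.cast (R := ℂ)) (Nat.choose_succ_right_eq n l)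
        push_cast [Nat.cast_sub h] at this
        linear_combination this
      · simp [Nat.choose_eq_zero_of_lt h, Nat.choose_eq_zero_of_lt (h.trans l.lt_succ_self)]
    rw [h1, Nat.add_sub_cancel]
    push_cast
    linear_combination (-1 / ((l + 1).factorial : ℂ) * y ^ (l + 1)) * h2

/-- Induction on `n` by differentiating in `s`. The variable `u = (1 - 2vs)⁻¹` is convenient because
`u' = 2v u²`; the exponent is `β (u - 1)` with `β = (a² + b²)/(2v)`. -/
theorem integral_pow_mul_cexp_sq_add_sq_gaussian {v : NNReal} (hv : v ≠ 0) (a b : ℝ) (n : ℕ) :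
    ∀ {s : ℂ}, 2 * v * s.re < 1 →
    ∫ p : ℝ × ℝ, (((a + p.1) ^ 2 + (b + p.2) ^ 2 : ℝ) : ℂ) ^ n *
        Complex.exp (s * (((a + p.1) ^ 2 + (b + p.2) ^ 2 : ℝ) : ℂ))
        ∂((gaussianReal 0 v).prod (gaussianReal 0 v))
      = n.factorial * (2 * v) ^ n * ((1 - 2 * v * s)⁻¹) ^ (n + 1) *
        Complex.exp (((a ^ 2 + b ^ 2) / (2 * v) : ℝ) * ((1 - 2 * v * s)⁻¹ - 1)) *
        laguerreNeg n (((a ^ 2 + b ^ 2) / (2 * v) : ℝ) * (1 - 2 * v * s)⁻¹) := by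
  have hv0 : (0 : ℝ) < v := by positivity
  have hvC : (v : ℂ) ≠ 0 := by exact_mod_cast hv0.ne'
  have hne : ∀ {s : ℂ}, 2 * v * s.re < 1 → (1 - 2 * v * s : ℂ) ≠ 0 := fun {s} hs h => by
    have : (1 - 2 * v * s : ℂ).re = 1 - 2 * v * s.re := by simp
    rw [h, Complex.zero_re] at this
    linarith
  have hopen : IsOpen {s : ℂ | 2 * v * s.re < 1} :=
    isOpen_lt (by fun_prop) continuous_const
  have hopen' : IsOpen {r : ℝ | 2 * v * r < 1} :=
    isOpen_lt (by fun_prop) continuous_const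
  induction n with
  | zero =>
    intro s hs
    have := hne hs
    simp only [pow_zero, one_mul, integral_cexp_mul_sq_add_sq_gaussian hv hs]
    simp only [laguerreNeg, zero_add, Finset.range_one, Finset.sum_singleton, pow_zero]
    simp only [Nat.factorial_zero, Nat.choose_self, Nat.cast_one, one_mul, pow_one, div_one,
      mul_one]
    congr 2
    generalize hD : (1 - 2 * v * s : ℂ) = D at this
    have : s = (1 - D) / (2 * v) := by rw [← hD]; field_simp; ring
    rw [this]
    push_cast
    field_simp
  | succ n ih =>
    intro s hs
    have hint : s.re ∈ interior (integrableExpSet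
        (fun p : ℝ × ℝ => (a + p.1) ^ 2 + (b + p.2) ^ 2)
        ((gaussianReal 0 v).prod (gaussianReal 0 v))) :=
      interior_maximal (fun r hr => (integral_exp_mul_sq_add_sq_gaussian hv hr a b).1) hopen' hs
    have h1 := hasDerivAt_integral_pow_mul_exp hint n
    -- The next moment and the derivative of the closed form are derivatives of the same function
    -- near `s`, hence equal.
    refine h1.unique (HasDerivAt.congr_of_eventuallyEq ?_
      (Filter.eventually_of_mem (hopen.mem_nhds hs) fun z hz => ih hz))
    set β : ℂ := (((a ^ 2 + b ^ 2) / (2 * v) : ℝ) : ℂ)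
    have h0 := hne hs
    have hd : HasDerivAt (fun z : ℂ => (1 - 2 * v * z)⁻¹) (2 * v * ((1 - 2 * v * s)⁻¹) ^ 2) s := by
      have : HasDerivAt (fun z : ℂ => 1 - 2 * v * z) (-(2 * v)) s := by
        simpa only [id, mul_one] using ((hasDerivAt_id s).const_mul (2 * v : ℂ)).const_sub 1
      convert! this.inv h0 using 1
      field_simp
    generalize hu : (1 - 2 * v * s : ℂ)⁻¹ = u at hd
    have hE : HasDerivAt (fun z : ℂ => Complex.exp (β * ((1 - 2 * v * z)⁻¹ - 1)))
        (Complex.exp (β * (u - 1)) * (β * (2 * v * u ^ 2))) s := by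
      have := ((hd.sub_const 1).const_mul β).cexp
      rwa [hu] at this
    have hL := (hasDerivAt_laguerreNeg n (β * (1 - 2 * v * s)⁻¹)).comp s (hd.const_mul β)
    have hP := hd.fun_pow (n + 1)
    have := ((hP.const_mul ((n.factorial : ℂ) * (2 * v) ^ n)).mul hE).mul hL
    refine this.congr_deriv ?_
    have hr := laguerreNeg_succ n (β * u)
    simp only [Pi.mul_apply, Function.comp_apply, hu]
    generalize laguerreNeg n (β * u) = L0 at hr ⊢
    generalize laguerreNeg (n + 1) (β * u) = L1 at hr ⊢
    generalize (∑ l ∈ Finset.range (n + 1),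
        (n.choose l : ℂ) / (l.factorial : ℂ) * (l * (β * u) ^ (l - 1))) = D at hr ⊢
    rw [Nat.factorial_succ, Nat.add_sub_cancel]
    push_cast
    linear_combination (-(n.factorial : ℂ) * (2 * v) ^ (n + 1) * u ^ (n + 2) *
      Complex.exp (β * (u - 1))) * hr

/-! ### Gamma average over the fluctuation -/

/-- The variable appears as `√u ^ 2` because the amplitudes carry `√ζ`; it differs from `u` only for
`u < 0`, where the Gamma density vanishes. -/
theorem integral_exp_mul_sq_sqrt_gammaMeasure {m : ℝ} (hm : 0 < m) {κ : ℝ} (hκ : κ < m) :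
    ∫ u, Real.exp (κ * Real.sqrt u ^ 2) ∂(gammaMeasure m m) = m ^ m * (m - κ) ^ (-m) := by
  have hG : Real.Gamma m ≠ 0 := (Real.Gamma_pos_of_pos hm).ne'
  have h1 : ∫ u, Real.exp (κ * Real.sqrt u ^ 2) ∂(gammaMeasure m m)
      = ∫ u, gammaPDFReal m m u * Real.exp (κ * Real.sqrt u ^ 2) := by
    rw [gammaMeasure, show gammaPDF m m = fun u => ENNReal.ofReal (gammaPDFReal m m u) from rfl,
      integral_withDensity_eq_integral_toReal_smul
      (measurable_gammaPDFReal m m).ennreal_ofReal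
      (Filter.Eventually.of_forall fun _ => ENNReal.ofReal_lt_top)]
    refine integral_congr_ae (Filter.Eventually.of_forall fun u => ?_)
    simp only [smul_eq_mul, ENNReal.toReal_ofReal (gammaPDFReal_nonneg hm hm u)]
  have h2 : (fun u => gammaPDFReal m m u * Real.exp (κ * Real.sqrt u ^ 2))
      = Set.indicator (Set.Ici 0) (fun u => m ^ m / Real.Gamma m *
        (u ^ (m - 1) * Real.exp (-((m - κ) * u)))) := by
    funext u
    by_cases hu : 0 ≤ u
    · rw [Set.indicator_of_mem (by exact hu), gammaPDFReal, if_pos hu, Real.sq_sqrt hu, mul_assoc,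
        ← Real.exp_add, mul_assoc]
      congr 4
      ring
    · rw [Set.indicator_of_notMem (by exact hu), gammaPDFReal, if_neg hu, zero_mul]
  rw [h1, h2, integral_indicator measurableSet_Ici, integral_Ici_eq_integral_Ioi,
    integral_const_mul, Real.integral_rpow_mul_exp_neg_mul_Ioi hm (sub_pos.2 hκ), one_div,
    Real.inv_rpow (sub_pos.2 hκ).le, ← Real.rpow_neg (sub_pos.2 hκ).le]
  field_simp

theorem integrable_exp_mul_sq_sqrt_gammaMeasure {m : ℝ} (hm : 0 < m) {κ : ℝ} (hκ : κ < m) :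
    Integrable (fun u => Real.exp (κ * Real.sqrt u ^ 2)) (gammaMeasure m m) := by
  refine Integrable.of_integral_ne_zero ?_
  rw [integral_exp_mul_sq_sqrt_gammaMeasure hm hκ]
  have := sub_pos.2 hκ
  positivity

theorem mem_interior_integrableExpSet_gammaMeasure {m : ℝ} (hm : 0 < m) {κ : ℝ} (hκ : κ < m) :
    κ ∈ interior (integrableExpSet (fun u => Real.sqrt u ^ 2) (gammaMeasure m m)) :=
  interior_maximal (s := integrableExpSet (fun u => Real.sqrt u ^ 2) (gammaMeasure m m))
    (fun _ hr => integrable_exp_mul_sq_sqrt_gammaMeasure hm hr) isOpen_Iio hκ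

theorem ofReal_sub_mem_slitPlane {m : ℝ} {κ : ℂ} (hκ : κ.re < m) :
    (m - κ : ℂ) ∈ Complex.slitPlane :=
  Complex.mem_slitPlane_iff.2 (Or.inl (by simpa using hκ))

theorem hasDerivAt_ofReal_sub_cpow {m : ℝ} (c : ℂ) {κ : ℂ} (hκ : κ.re < m) :
    HasDerivAt (fun z : ℂ => (m - z) ^ (-c)) (c * (m - κ) ^ (-(c + 1))) κ := by
  have h : HasDerivAt (fun z : ℂ => (m : ℂ) - z) (-1) κ := (hasDerivAt_id κ).const_sub _
  convert! h.cpow_const (c := -c) (ofReal_sub_mem_slitPlane hκ) using 1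
  rw [show -(c + 1) = -c - 1 by ring]
  ring

theorem integral_pow_mul_cexp_gammaMeasure {m : ℝ} (hm : 0 < m) (n : ℕ) : ∀ {κ : ℂ}, κ.re < m →
    ∫ u, ((Real.sqrt u ^ 2 : ℝ) : ℂ) ^ n * Complex.exp (κ * ((Real.sqrt u ^ 2 : ℝ) : ℂ))
        ∂(gammaMeasure m m)
      = ((m ^ m : ℝ) : ℂ) * (ascPochhammer ℂ n).eval (m : ℂ) * (m - κ) ^ (-(m + n : ℂ)) := by
  have hopen : IsOpen {z : ℂ | z.re < m} := isOpen_lt Complex.continuous_re continuous_const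
  induction n with
  | zero =>
    intro κ hκ
    simp only [pow_zero, one_mul, ascPochhammer_zero, Polynomial.eval_one, mul_one, Nat.cast_zero,
      add_zero]
    have hA : AnalyticOnNhd ℂ (complexMGF (fun u => Real.sqrt u ^ 2) (gammaMeasure m m))
        {z : ℂ | z.re < m} :=
      analyticOnNhd_complexMGF.mono fun z hz => mem_interior_integrableExpSet_gammaMeasure hm hz
    have hB : AnalyticOnNhd ℂ (fun κ : ℂ => ((m ^ m : ℝ) : ℂ) * (m - κ) ^ (-(m : ℂ)))
        {z : ℂ | z.re < m} :=
      DifferentiableOn.analyticOnNhd (fun z hz => ((hasDerivAt_ofReal_sub_cpow (m : ℂ)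
        hz).const_mul _).differentiableAt.differentiableWithinAt) hopen
    have hconn : IsPreconnected {z : ℂ | z.re < m} := (convex_halfSpace_re_lt m).isPreconnected
    have hreal : ∀ x : ℝ, x < m → complexMGF (fun u => Real.sqrt u ^ 2) (gammaMeasure m m) x
        = ((m ^ m : ℝ) : ℂ) * (m - x) ^ (-(m : ℂ)) := fun x hx => by
      rw [complexMGF_ofReal, mgf, integral_exp_mul_sq_sqrt_gammaMeasure hm hx,
        Complex.ofReal_mul, Complex.ofReal_cpow (sub_pos.2 hx).le]
      push_cast
      rfl
    have h0 : (0 : ℂ) ∈ {z : ℂ | z.re < m} := by simpa using hm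
    -- Both sides are analytic on `Re κ < m` and agree at real points accumulating at `0`; the
    -- identity theorem does the rest.
    refine hA.eqOn_of_preconnected_of_frequently_eq hB hconn h0 ?_ hκ
    have hlim : Filter.Tendsto (fun x : ℝ => (x : ℂ)) (nhdsWithin 0 {0}ᶜ)
        (nhdsWithin 0 {0}ᶜ) := by
      refine tendsto_nhdsWithin_iff.2 ⟨?_, ?_⟩
      · exact (Complex.continuous_ofReal.tendsto' 0 0 (by simp)).mono_left nhdsWithin_le_nhds
      · filter_upwards [self_mem_nhdsWithin] with x hx
        simpa using hx
    refine hlim.frequently (Filter.Eventually.frequently ?_)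
    filter_upwards [mem_nhdsWithin_of_mem_nhds (Iio_mem_nhds hm)] with x hx using hreal x hx
  | succ n ih =>
    intro κ hκ
    have h1 := hasDerivAt_integral_pow_mul_exp (mem_interior_integrableExpSet_gammaMeasure hm hκ) n
    refine h1.unique (HasDerivAt.congr_of_eventuallyEq ?_
      (Filter.eventually_of_mem (hopen.mem_nhds hκ) fun z hz => ih hz))
    convert! (hasDerivAt_ofReal_sub_cpow (m + n : ℂ) hκ).const_mul
      (((m ^ m : ℝ) : ℂ) * (ascPochhammer ℂ n).eval (m : ℂ)) using 1
    rw [ascPochhammer_succ_eval]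
    push_cast
    rw [add_assoc]
    ring

theorem integrable_pow_mul_exp_gammaMeasure {m : ℝ} (hm : 0 < m) (n : ℕ) {κ : ℝ} (hκ : κ < m) :
    Integrable (fun u => (Real.sqrt u ^ 2) ^ n * Real.exp (κ * Real.sqrt u ^ 2))
      (gammaMeasure m m) :=
  integrable_pow_mul_exp_of_mem_interior_integrableExpSet
    (mem_interior_integrableExpSet_gammaMeasure hm hκ) n

/-! ### Average over the phases -/

instance isProbabilityMeasure_uniformPhase : IsProbabilityMeasure uniformPhase :=
  cond_isProbabilityMeasure_of_finite (by simp [Real.pi_pos])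
    (by rw [Real.volume_Ico]; exact ENNReal.ofReal_ne_top)

theorem integral_uniformPhase (f : ℝ → ℂ) :
    ∫ φ, f φ ∂uniformPhase = (2 * Real.pi : ℂ)⁻¹ * ∫ φ in (0 : ℝ)..(2 * Real.pi), f φ := by
  rw [uniformPhase, ProbabilityTheory.cond, integral_smul_measure, Real.volume_Ico, sub_zero, ENNReal.toReal_inv,
    ENNReal.toReal_ofReal Real.two_pi_pos.le, intervalIntegral.integral_of_le Real.two_pi_pos.le,
    integral_Ico_eq_integral_Ioc, Complex.real_smul]
  push_cast
  rfl

/-- Periodicity makes the inner average independent of `φ₁`. The substitution `x = 2θ + π` turns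
`cos x` into `2 sin² θ - 1`, the variable of `eulerIntegral`. -/
theorem integral_integral_cos_sub_uniformPhase (h : ℝ → ℂ) :
    ∫ φ₁, ∫ φ₂, h (Real.cos (φ₁ - φ₂)) ∂uniformPhase ∂uniformPhase
      = (Real.pi : ℂ)⁻¹ * ∫ θ in (0 : ℝ)..Real.pi, h (2 * Real.sin θ ^ 2 - 1) := by
  have hper : Function.Periodic (fun x => h (Real.cos x)) (2 * Real.pi) := fun x => by
    simp only [Real.cos_add_two_pi]
  have h1 : ∀ θ, h (2 * Real.sin θ ^ 2 - 1) = h (Real.cos (2 * θ + Real.pi)) := fun θ => by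
    rw [Real.cos_add_pi, Real.cos_two_mul, Real.cos_sq']; congr 1; ring
  have h2 : ∫ θ in (0 : ℝ)..Real.pi, h (2 * Real.sin θ ^ 2 - 1)
      = (2 : ℂ)⁻¹ * ∫ x in Real.pi..(Real.pi + 2 * Real.pi), h (Real.cos x) := by
    simp_rw [h1]
    rw [intervalIntegral.integral_comp_mul_add (fun x => h (Real.cos x)) two_ne_zero Real.pi,
      mul_zero, zero_add, add_comm (2 * Real.pi), Complex.real_smul]
    push_cast
    rfl
  have h3 : ∀ φ₁, ∫ φ₂, h (Real.cos (φ₁ - φ₂)) ∂uniformPhase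
      = (Real.pi : ℂ)⁻¹ * ∫ θ in (0 : ℝ)..Real.pi, h (2 * Real.sin θ ^ 2 - 1) := fun φ₁ => by
    rw [integral_uniformPhase, h2,
      intervalIntegral.integral_comp_sub_left (fun x => h (Real.cos x)) φ₁, sub_zero, mul_inv_rev,
      mul_assoc]
    have := hper.intervalIntegral_add_eq (φ₁ - 2 * Real.pi) Real.pi
    rw [sub_add_cancel] at this
    rw [this]
  simp_rw [h3]
  simp

/-! ### Convergence and iterated integration -/

/-- The exponential rate in `ζ` must stay below the Gamma decay rate `m` for all phases at once. The
key inequality is `Re(1/D) = Re D / |D|² ≤ 1 / Re D` for `D = 1 - w s`. -/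
theorem exists_bound_re_mul_inv_sub_one {m K Δ w : ℝ} (hm : 0 < m) (hK : 0 ≤ K) (hΔ : 0 ≤ Δ)
    {s : ℂ} (hs : (m + K * (1 + Δ)) * (w * s.re) < m) :
    w * s.re < 1 ∧ ∃ κ < m, ∀ c : ℝ, 0 ≤ c → c ≤ 1 + Δ →
      (K * c * ((1 - w * s)⁻¹ - 1) : ℂ).re ≤ κ := by
  have hKΔ : 0 ≤ K * (1 + Δ) := by positivity
  have h1 : w * s.re < 1 := by
    by_contra! h
    nlinarith
  -- The worst case is `c = 1 + Δ` when `Re s > 0` and `c = 0` otherwise, hence the positive part;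
  -- its being below `m` is `hs` after clearing `1 - w Re s`.
  refine ⟨h1, K * (1 + Δ) * max ((1 - w * s.re)⁻¹ - 1) 0, ?_, fun c hc0 hc1 => ?_⟩
  · have hd : 0 < 1 - w * s.re := by linarith
    rw [mul_max_of_nonneg _ _ hKΔ, mul_zero]
    refine max_lt ?_ hm
    have : K * (1 + Δ) * ((1 - w * s.re)⁻¹ - 1) = K * (1 + Δ) * (w * s.re) / (1 - w * s.re) := by
      field_simp
      ring
    rw [this, div_lt_iff₀ hd]
    linarith
  · have hre : (K * c * ((1 - w * s)⁻¹ - 1) : ℂ).re = K * c * (((1 - w * s)⁻¹ : ℂ).re - 1) := by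
      rw [← Complex.ofReal_mul, Complex.re_ofReal_mul, Complex.sub_re, Complex.one_re]
    have hD : (1 - w * s : ℂ).re = 1 - w * s.re := by simp
    have hd : 0 < (1 - w * s : ℂ).re := by rw [hD]; linarith
    have hle : ((1 - w * s)⁻¹ : ℂ).re ≤ (1 - w * s.re)⁻¹ := by
      rw [Complex.inv_re, ← hD, inv_eq_one_div, div_le_div_iff₀ (by
        rw [Complex.normSq_pos]; intro h; simp [h] at hd) hd, Complex.normSq_apply]
      nlinarith [mul_self_nonneg (1 - w * s : ℂ).im]
    rw [hre]
    calc K * c * (((1 - w * s)⁻¹ : ℂ).re - 1)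
        ≤ K * c * max ((1 - w * s.re)⁻¹ - 1) 0 := by
          gcongr ?_ * ?_
          exact (sub_le_sub_right hle 1).trans (le_max_left _ _)
      _ ≤ K * (1 + Δ) * max ((1 - w * s.re)⁻¹ - 1) 0 := by gcongr

/-- The joint law of `(ζ, φ₁, φ₂, X, Y)`. -/
noncomputable def channelMeasure (m : ℝ) (v : NNReal) : Measure (ℝ × ℝ × ℝ × ℝ × ℝ) :=
  (gammaMeasure m m).prod (uniformPhase.prod (uniformPhase.prod
    ((gaussianReal 0 v).prod (gaussianReal 0 v))))

/-- The received power `|V|²` as a function of `(ζ, φ₁, φ₂, X, Y)`. -/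
noncomputable def channelPower (V₁ V₂ : ℝ) (p : ℝ × ℝ × ℝ × ℝ × ℝ) : ℝ :=
  ‖receivedSignal V₁ V₂ p.1 p.2.1 p.2.2.1 p.2.2.2.1 p.2.2.2.2‖ ^ 2

theorem continuous_channelPower (V₁ V₂ : ℝ) : Continuous (channelPower V₁ V₂) := by
  unfold channelPower receivedSignal
  fun_prop

theorem channelPower_eq (V₁ V₂ ζ φ₁ φ₂ : ℝ) (q : ℝ × ℝ) :
    channelPower V₁ V₂ (ζ, φ₁, φ₂, q) =
      (Real.sqrt ζ * (V₁ * Real.cos φ₁ + V₂ * Real.cos φ₂) + q.1) ^ 2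
      + (Real.sqrt ζ * (V₁ * Real.sin φ₁ + V₂ * Real.sin φ₂) + q.2) ^ 2 := by
  rw [channelPower, Complex.sq_norm, Complex.normSq_apply, receivedSignal, mul_comm Complex.I,
    mul_comm Complex.I, mul_comm Complex.I, Complex.exp_mul_I, Complex.exp_mul_I]
  simp only [← Complex.ofReal_cos, ← Complex.ofReal_sin, ← Complex.ofReal_mul, Complex.add_re,
    Complex.add_im, Complex.re_ofReal_mul, Complex.im_ofReal_mul, Complex.ofReal_re,
    Complex.ofReal_im, Complex.I_re, Complex.I_im]
  ring

/-- Law of cosines for two phasors. The product form of the relation for `Δ` also covers `V₁ = V₂ =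
0`. -/
theorem specular_power_eq {V₁ V₂ K Δ w : ℝ} (hw : 0 < w) (hK : K * w = V₁ ^ 2 + V₂ ^ 2)
    (hΔ : Δ * (V₁ ^ 2 + V₂ ^ 2) = 2 * V₁ * V₂) (ζ φ₁ φ₂ : ℝ) :
    ((Real.sqrt ζ * (V₁ * Real.cos φ₁ + V₂ * Real.cos φ₂)) ^ 2
      + (Real.sqrt ζ * (V₁ * Real.sin φ₁ + V₂ * Real.sin φ₂)) ^ 2) / w
      = Real.sqrt ζ ^ 2 * (K * (1 + Δ * Real.cos (φ₁ - φ₂))) := by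
  rw [div_eq_iff hw.ne', Real.cos_sub]
  have h1 := Real.sin_sq_add_cos_sq φ₁
  have h2 := Real.sin_sq_add_cos_sq φ₂
  rw [← hK] at hΔ
  linear_combination Real.sqrt ζ ^ 2 * (V₁ ^ 2 * h1 + V₂ ^ 2 * h2 - hK
    - (Real.cos φ₁ * Real.cos φ₂ + Real.sin φ₁ * Real.sin φ₂) * hΔ)

theorem one_add_mul_cos_mem_Icc {Δ : ℝ} (h0 : 0 ≤ Δ) (h1 : Δ ≤ 1) {x : ℝ} (hx : x ∈ Set.Icc (-1) 1) :
    0 ≤ 1 + Δ * x ∧ 1 + Δ * x ≤ 1 + Δ := by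
  obtain ⟨hx0, hx1⟩ := hx
  constructor <;> nlinarith

section

variable {m V₁ V₂ K Δ : ℝ} {v : NNReal}

/-- Tonelli: the Gaussian integral is bounded independently of the phases by a multiple of `exp(κ
ζ)` with `κ < m`; the phases have total mass one, and the Gamma law integrates the bound. -/
theorem integrable_exp_channelPower (hm : 0 < m) (hv : v ≠ 0) (hK0 : 0 ≤ K)
    (hK : K * (2 * v) = V₁ ^ 2 + V₂ ^ 2)
    (hΔ0 : 0 ≤ Δ) (hΔ1 : Δ ≤ 1) (hΔ : Δ * (V₁ ^ 2 + V₂ ^ 2) = 2 * V₁ * V₂) {r : ℝ}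
    (hr : (m + K * (1 + Δ)) * (2 * v * r) < m) :
    Integrable (fun p => Real.exp (r * channelPower V₁ V₂ p)) (channelMeasure m v) := by
  have hv0 : (0 : ℝ) < v := by positivity
  obtain ⟨h1, κ, hκm, hκ⟩ := exists_bound_re_mul_inv_sub_one (w := 2 * v) (s := (r : ℂ)) hm hK0 hΔ0 hr
  rw [Complex.ofReal_re] at h1
  have hd : 0 < 1 - 2 * v * r := by linarith
  have : IsProbabilityMeasure (gammaMeasure m m) := isProbabilityMeasure_gammaMeasure hm hm
  have hcont : Continuous (fun p => ENNReal.ofReal (Real.exp (r * channelPower V₁ V₂ p))) := by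
    have := continuous_channelPower V₁ V₂
    exact ENNReal.continuous_ofReal.comp (by fun_prop)
  have hinner : ∀ ζ φ₁ φ₂ : ℝ, ∫⁻ q, ENNReal.ofReal (Real.exp (r * channelPower V₁ V₂ (ζ, φ₁, φ₂, q)))
        ∂((gaussianReal 0 v).prod (gaussianReal 0 v))
      ≤ ENNReal.ofReal ((1 - 2 * v * r)⁻¹ * Real.exp (κ * Real.sqrt ζ ^ 2)) := fun ζ φ₁ φ₂ => by
    simp_rw [channelPower_eq]
    obtain ⟨hi, he⟩ := integral_exp_mul_sq_add_sq_gaussian hv h1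
      (Real.sqrt ζ * (V₁ * Real.cos φ₁ + V₂ * Real.cos φ₂))
      (Real.sqrt ζ * (V₁ * Real.sin φ₁ + V₂ * Real.sin φ₂))
    rw [← ofReal_integral_eq_lintegral_ofReal hi
      (Filter.Eventually.of_forall fun _ => (Real.exp_pos _).le), he]
    refine ENNReal.ofReal_le_ofReal (mul_le_mul_of_nonneg_left (Real.exp_le_exp.2 ?_)
      (inv_nonneg.2 hd.le))
    have hs := specular_power_eq (w := 2 * v) (by positivity) hK hΔ ζ φ₁ φ₂
    rw [div_eq_iff (by positivity)] at hs
    obtain ⟨hc0, hc1⟩ := one_add_mul_cos_mem_Icc hΔ0 hΔ1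
      ⟨Real.neg_one_le_cos (φ₁ - φ₂), Real.cos_le_one (φ₁ - φ₂)⟩
    have hb := hκ _ hc0 hc1
    have hcast : (K * ((1 + Δ * Real.cos (φ₁ - φ₂) : ℝ) : ℂ) * ((1 - ((2 * v : ℝ) : ℂ) * r)⁻¹ - 1) : ℂ)
        = ((K * (1 + Δ * Real.cos (φ₁ - φ₂)) * ((1 - 2 * v * r)⁻¹ - 1) : ℝ) : ℂ) := by
      push_cast; rfl
    rw [hcast, Complex.ofReal_re] at hb
    rw [hs]
    refine le_trans (le_of_eq ?_) (mul_le_mul_of_nonneg_right hb (sq_nonneg (Real.sqrt ζ)))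
    field_simp
    ring
  refine ⟨?_, ?_⟩
  · have := continuous_channelPower V₁ V₂
    exact Continuous.aestronglyMeasurable (by fun_prop)
  · rw [hasFiniteIntegral_iff_ofReal (Filter.Eventually.of_forall fun _ => (Real.exp_pos _).le),
      channelMeasure, lintegral_prod _ hcont.measurable.aemeasurable]
    refine lt_of_le_of_lt (lintegral_mono (g := fun ζ =>
      ENNReal.ofReal ((1 - 2 * v * r)⁻¹ * Real.exp (κ * Real.sqrt ζ ^ 2))) fun ζ => ?_) ?_
    · beta_reduce
      rw [lintegral_prod _ (by
        refine (hcont.comp (g := _) (f := fun q => (ζ, q)) ?_).measurable.aemeasurable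
        fun_prop)]
      refine (lintegral_mono (g := fun _ =>
        ENNReal.ofReal ((1 - 2 * v * r)⁻¹ * Real.exp (κ * Real.sqrt ζ ^ 2))) fun φ₁ => ?_).trans
        (by simp)
      beta_reduce
      rw [lintegral_prod _ (by
        refine (hcont.comp (g := _) (f := fun q => (ζ, φ₁, q)) ?_).measurable.aemeasurable
        fun_prop)]
      exact (lintegral_mono (g := fun _ =>
        ENNReal.ofReal ((1 - 2 * v * r)⁻¹ * Real.exp (κ * Real.sqrt ζ ^ 2)))
        fun φ₂ => hinner ζ φ₁ φ₂).trans (by simp)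
    · have := ((integrable_exp_mul_sq_sqrt_gammaMeasure hm hκm).const_mul (1 - 2 * v * r)⁻¹)
      rw [← ofReal_integral_eq_lintegral_ofReal this (Filter.Eventually.of_forall fun _ => by
        have := inv_nonneg.2 hd.le
        positivity)]
      exact ENNReal.ofReal_lt_top

theorem integrable_pow_mul_cexp_channelPower (hm : 0 < m) (hv : v ≠ 0) (hK0 : 0 ≤ K)
    (hK : K * (2 * v) = V₁ ^ 2 + V₂ ^ 2)
    (hΔ0 : 0 ≤ Δ) (hΔ1 : Δ ≤ 1) (hΔ : Δ * (V₁ ^ 2 + V₂ ^ 2) = 2 * V₁ * V₂) (n : ℕ) {s : ℂ}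
    (hs : (m + K * (1 + Δ)) * (2 * v * s.re) < m) :
    Integrable (fun p => (channelPower V₁ V₂ p : ℂ) ^ n * Complex.exp (s * channelPower V₁ V₂ p))
      (channelMeasure m v) := by
  refine integrable_pow_mul_cexp_of_re_mem_interior_integrableExpSet ?_ n
  refine interior_maximal (t := {r : ℝ | (m + K * (1 + Δ)) * (2 * v * r) < m})
    (fun r hr => integrable_exp_channelPower hm hv hK0 hK hΔ0 hΔ1 hΔ hr) ?_ hs
  exact isOpen_lt (by fun_prop) continuous_const

/-- The conditional generalized moment generating function given `ζ` (entering as `x`) and the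
normalised specular power `c`. -/
noncomputable def conditionalGmgf (n : ℕ) (w K : ℝ) (u : ℂ) (x c : ℝ) : ℂ :=
  n.factorial * (w : ℂ) ^ n * u ^ (n + 1) * Complex.exp ((x * (K * c) : ℝ) * (u - 1)) *
    laguerreNeg n ((x * (K * c) : ℝ) * u)

theorem integral_channelMeasure_eq_conditionalGmgf (hm : 0 < m) (hv : v ≠ 0) (hK0 : 0 ≤ K)
    (hK : K * (2 * v) = V₁ ^ 2 + V₂ ^ 2)
    (hΔ0 : 0 ≤ Δ) (hΔ1 : Δ ≤ 1) (hΔ : Δ * (V₁ ^ 2 + V₂ ^ 2) = 2 * V₁ * V₂) (n : ℕ) {s : ℂ}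
    (hs : (m + K * (1 + Δ)) * (2 * v * s.re) < m) :
    ∫ p, (channelPower V₁ V₂ p : ℂ) ^ n * Complex.exp (s * channelPower V₁ V₂ p)
        ∂(channelMeasure m v)
      = (Real.pi : ℂ)⁻¹ * ∫ ζ, (∫ θ in (0 : ℝ)..Real.pi, conditionalGmgf n (2 * v) K
          (1 - 2 * v * s)⁻¹ (Real.sqrt ζ ^ 2) (1 + Δ * (2 * Real.sin θ ^ 2 - 1)))
          ∂(gammaMeasure m m) := by
  have hv0 : (0 : ℝ) < v := by positivity
  have : IsProbabilityMeasure (gammaMeasure m m) := isProbabilityMeasure_gammaMeasure hm hm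
  have h1 := (exists_bound_re_mul_inv_sub_one (w := 2 * v) (s := s) hm hK0 hΔ0 hs).1
  have hint := integrable_pow_mul_cexp_channelPower hm hv hK0 hK hΔ0 hΔ1 hΔ n hs
  have hinner : ∀ ζ φ₁ φ₂ : ℝ, ∫ q, (channelPower V₁ V₂ (ζ, φ₁, φ₂, q) : ℂ) ^ n *
        Complex.exp (s * channelPower V₁ V₂ (ζ, φ₁, φ₂, q))
        ∂((gaussianReal 0 v).prod (gaussianReal 0 v))
      = conditionalGmgf n (2 * v) K (1 - 2 * v * s)⁻¹ (Real.sqrt ζ ^ 2)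
          (1 + Δ * Real.cos (φ₁ - φ₂)) := fun ζ φ₁ φ₂ => by
    simp_rw [channelPower_eq]
    rw [integral_pow_mul_cexp_sq_add_sq_gaussian hv _ _ n h1,
      specular_power_eq (w := 2 * v) (by positivity) hK hΔ ζ φ₁ φ₂, conditionalGmgf]
    push_cast
    rfl
  rw [← integral_const_mul]
  unfold channelMeasure at hint ⊢
  refine (integral_prod _ hint).trans ?_
  refine integral_congr_ae ?_
  filter_upwards [hint.prod_right_ae] with ζ hζ
  refine (integral_prod _ hζ).trans ?_
  rw [← integral_integral_cos_sub_uniformPhase (fun x =>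
    conditionalGmgf n (2 * v) K (1 - 2 * v * s)⁻¹ (Real.sqrt ζ ^ 2) (1 + Δ * x))]
  refine integral_congr_ae ?_
  filter_upwards [hζ.prod_right_ae] with φ₁ hφ₁
  refine (integral_prod _ hφ₁).trans ?_
  exact integral_congr_ae (Filter.Eventually.of_forall fun φ₂ => hinner ζ φ₁ φ₂)

theorem integral_integral_conditionalGmgf (hm : 0 < m) (hΔ0 : 0 ≤ Δ) (hΔ1 : Δ ≤ 1) (n : ℕ)
    (w : ℝ) {u : ℂ} {κ : ℝ} (hκm : κ < m)
    (hκ : ∀ c : ℝ, 0 ≤ c → c ≤ 1 + Δ → (K * c * (u - 1) : ℂ).re ≤ κ) :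
    ∫ ζ, (∫ θ in (0 : ℝ)..Real.pi, conditionalGmgf n w K
          u (Real.sqrt ζ ^ 2) (1 + Δ * (2 * Real.sin θ ^ 2 - 1))) ∂(gammaMeasure m m)
      = n.factorial * (w : ℂ) ^ n * u ^ (n + 1) * ∑ l ∈ Finset.range (n + 1),
        (n.choose l : ℂ) / (l.factorial : ℂ) * (K * u) ^ l * (((m ^ m : ℝ) : ℂ) *
          (ascPochhammer ℂ l).eval (m : ℂ)) * ∫ θ in (0 : ℝ)..Real.pi,
          ((1 + Δ * (2 * Real.sin θ ^ 2 - 1) : ℝ) : ℂ) ^ l *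
          (m - K * ((1 + Δ * (2 * Real.sin θ ^ 2 - 1) : ℝ) : ℂ) * (u - 1)) ^ (-(m + l : ℂ)) := by
  have : IsProbabilityMeasure (gammaMeasure m m) := isProbabilityMeasure_gammaMeasure hm hm
  set c : ℝ → ℝ := fun θ => 1 + Δ * (2 * Real.sin θ ^ 2 - 1) with hc
  have hcc : Continuous c := by fun_prop
  have hcI : ∀ θ, 0 ≤ c θ ∧ c θ ≤ 1 + Δ := fun θ => one_add_mul_cos_mem_Icc hΔ0 hΔ1
    ⟨by nlinarith [sq_nonneg (Real.sin θ)], by nlinarith [Real.sin_sq_le_one θ]⟩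
  let f : ℕ → ℝ × ℝ → ℂ := fun l p => ((c p.2 : ℝ) : ℂ) ^ l *
    (((Real.sqrt p.1 ^ 2 : ℝ) : ℂ) ^ l *
      Complex.exp (K * c p.2 * (u - 1) * ((Real.sqrt p.1 ^ 2 : ℝ) : ℂ)))
  have hf : ∀ l, Integrable (f l) ((gammaMeasure m m).prod (volume.restrict (Set.Ioc 0 Real.pi))) := by
    intro l
    -- Since `0 ≤ c ≤ 1 + Δ` and the real exponent is at most `κ ζ`, this majorant is free of `θ`
    -- and permits exchanging the two integrals.
    have hb := (((integrable_pow_mul_exp_gammaMeasure hm l hκm).const_mul ((1 + Δ) ^ l)).comp_fst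
      (volume.restrict (Set.Ioc 0 Real.pi)))
    refine hb.mono' (Continuous.aestronglyMeasurable (by fun_prop)) ?_
    refine Filter.Eventually.of_forall fun p => ?_
    obtain ⟨h0, h1⟩ := hcI p.2
    simp only [f, norm_mul, norm_pow, Complex.norm_real, Complex.norm_exp, Complex.re_mul_ofReal]
    rw [Real.norm_of_nonneg h0, Real.norm_of_nonneg (Real.sqrt_nonneg p.1)]
    gcongr
    exact hκ _ h0 h1
  have hH : ∀ ζ θ, conditionalGmgf n w K u (Real.sqrt ζ ^ 2) (c θ) =
      n.factorial * (w : ℂ) ^ n * u ^ (n + 1) * ∑ l ∈ Finset.range (n + 1),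
        (n.choose l : ℂ) / (l.factorial : ℂ) * (K * u) ^ l * f l (ζ, θ) := fun ζ θ => by
    rw [conditionalGmgf, laguerreNeg, mul_assoc _ (Complex.exp _), Finset.mul_sum]
    congr 1
    refine Finset.sum_congr rfl fun l _ => ?_
    have : (((Real.sqrt ζ ^ 2 * (K * c θ) : ℝ) : ℂ) * (u - 1))
        = K * c θ * (u - 1) * ((Real.sqrt ζ ^ 2 : ℝ) : ℂ) := by push_cast; ring
    simp only [f, this]
    push_cast
    ring
  have hsum : Integrable (fun p : ℝ × ℝ => n.factorial * (w : ℂ) ^ n * u ^ (n + 1) *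
      ∑ l ∈ Finset.range (n + 1), (n.choose l : ℂ) / (l.factorial : ℂ) * (K * u) ^ l * f l p)
      ((gammaMeasure m m).prod (volume.restrict (Set.Ioc 0 Real.pi))) :=
    (integrable_finsetSum _ fun l _ => (hf l).const_mul _).const_mul _
  simp_rw [intervalIntegral.integral_of_le Real.pi_pos.le]
  calc _ = ∫ ζ, (∫ θ in Set.Ioc 0 Real.pi, n.factorial * (w : ℂ) ^ n * u ^ (n + 1) *
      ∑ l ∈ Finset.range (n + 1), (n.choose l : ℂ) / (l.factorial : ℂ) * (K * u) ^ l * f l (ζ, θ))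
        ∂(gammaMeasure m m) := by simp_rw [← hH]; rfl
    _ = _ := by
      refine (integral_prod _ hsum).symm.trans ?_
      rw [integral_const_mul, integral_finsetSum _
        fun l _ => (hf l).const_mul _]
      congr 1
      refine Finset.sum_congr rfl fun l _ => ?_
      rw [integral_const_mul, integral_prod_symm _ (hf l), mul_assoc _ (_ * _)]
      congr 1
      rw [← integral_const_mul]
      refine integral_congr_ae (Filter.Eventually.of_forall fun θ => ?_)
      simp only [f]
      rw [integral_const_mul, integral_pow_mul_cexp_gammaMeasure hm l
        ((hκ _ (hcI θ).1 (hcI θ).2).trans_lt hκm)]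
      ring

end

/-! ### Assembly of the closed form -/

/-- Both arguments lie in `(-π/2, π/2)`, so their difference stays in `(-π, π)` and the principal
logarithm is additive. -/
theorem div_cpow_of_re_pos {x y : ℂ} (hx : 0 < x.re) (hy : 0 < y.re) (a : ℂ) :
    (x / y) ^ a = x ^ a / y ^ a := by
  have hx0 : x ≠ 0 := fun h => by simp [h] at hx
  have hy0 : y ≠ 0 := fun h => by simp [h] at hy
  have h1 := abs_lt.1 (Complex.abs_arg_lt_pi_div_two_iff.2 (Or.inl hx))
  have h2 := abs_lt.1 (Complex.abs_arg_lt_pi_div_two_iff.2 (Or.inl hy))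
  have hpi := Real.pi_pos
  have harg : y.arg ≠ Real.pi := by intro h; linarith
  have hlog : Complex.log (x * y⁻¹) = Complex.log x + Complex.log y⁻¹ := by
    refine Complex.log_mul hx0 (inv_ne_zero hy0) ?_
    rw [Complex.arg_inv, if_neg harg]
    constructor <;> linarith
  rw [div_eq_mul_inv, div_eq_mul_inv, ← Complex.inv_cpow _ _ harg,
    Complex.cpow_def_of_ne_zero (mul_ne_zero hx0 (inv_ne_zero hy0)),
    Complex.cpow_def_of_ne_zero hx0, Complex.cpow_def_of_ne_zero (inv_ne_zero hy0), hlog, add_mul,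
    Complex.exp_add]

theorem div_mem_slitPlane_of_re_pos {x y : ℂ} (hx : 0 < x.re) (hy : 0 < y.re) :
    x / y ∈ Complex.slitPlane := by
  have hy0 : y ≠ 0 := fun h => by simp [h] at hy
  have hn : 0 < Complex.normSq y := Complex.normSq_pos.2 hy0
  rw [Complex.mem_slitPlane_iff]
  by_contra! h
  obtain ⟨h1, h2⟩ := h
  have hx' : x = ((x / y).re : ℂ) * y := by
    have : (((x / y).re : ℝ) : ℂ) = x / y := Complex.ext rfl (by simpa using h2.symm)
    rw [this, div_mul_cancel₀ _ hy0]
  rw [hx', Complex.re_ofReal_mul] at hx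
  nlinarith

theorem ofReal_ascPochhammer_eval (l : ℕ) (m : ℝ) :
    (((ascPochhammer ℝ l).eval m : ℝ) : ℂ) = (ascPochhammer ℂ l).eval (m : ℂ) := by
  induction l with
  | zero => simp
  | succ l ih => rw [ascPochhammer_succ_eval, ascPochhammer_succ_eval, ← ih]; push_cast; rfl

theorem integral_one_add_mul_two_sin_sq_sub_one (Δ : ℝ) :
    ∫ θ in (0 : ℝ)..Real.pi, (1 + Δ * (2 * Real.sin θ ^ 2 - 1)) = Real.pi := by
  have h := integral_sin_sq_pow 1
  simp only [pow_one, wallisRatio, Finset.range_one, Finset.prod_singleton] at h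
  have h2 : ∀ θ : ℝ, 1 + Δ * (2 * Real.sin θ ^ 2 - 1) = (1 - Δ) + 2 * Δ * Real.sin θ ^ 2 :=
    fun θ => by ring
  simp_rw [h2]
  rw [intervalIntegral.integral_add intervalIntegrable_const
    ((by fun_prop : Continuous fun θ : ℝ => 2 * Δ * Real.sin θ ^ 2).intervalIntegrable _ _),
    intervalIntegral.integral_const_mul, h, intervalIntegral.integral_const]
  simp only [smul_eq_mul]
  norm_num
  ring

section

variable {m V₁ V₂ K Δ : ℝ} {v : NNReal}

theorem integral_pow_mul_cexp_channelPower (hm : 0 < m) (hv : v ≠ 0) (hK0 : 0 ≤ K)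
    (hK : K * (2 * v) = V₁ ^ 2 + V₂ ^ 2)
    (hΔ0 : 0 ≤ Δ) (hΔ1 : Δ ≤ 1) (hΔ : Δ * (V₁ ^ 2 + V₂ ^ 2) = 2 * V₁ * V₂) (n : ℕ) {s : ℂ}
    (hs : (m + K * (1 + Δ)) * (2 * v * s.re) < m) :
    ∫ p, (channelPower V₁ V₂ p : ℂ) ^ n * Complex.exp (s * channelPower V₁ V₂ p)
        ∂(channelMeasure m v)
      = n.factorial * (2 * v : ℂ) ^ n * (1 - 2 * v * s)⁻¹ ^ (n + 1) * ∑ l ∈ Finset.range (n + 1),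
        (n.choose l : ℂ) / (l.factorial : ℂ) * (K * (1 - 2 * v * s)⁻¹) ^ l * (((m ^ m : ℝ) : ℂ) *
          (ascPochhammer ℂ l).eval (m : ℂ)) * ((Real.pi : ℂ)⁻¹ * ∫ θ in (0 : ℝ)..Real.pi,
          ((1 + Δ * (2 * Real.sin θ ^ 2 - 1) : ℝ) : ℂ) ^ l *
          (m - K * ((1 + Δ * (2 * Real.sin θ ^ 2 - 1) : ℝ) : ℂ) * ((1 - 2 * v * s)⁻¹ - 1))
            ^ (-(m + l : ℂ))) := by
  obtain ⟨-, κ, hκm, hκ⟩ := exists_bound_re_mul_inv_sub_one (w := 2 * v) (s := s) hm hK0 hΔ0 hs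
  push_cast at hκ
  rw [integral_channelMeasure_eq_conditionalGmgf hm hv hK0 hK hΔ0 hΔ1 hΔ n hs,
    integral_integral_conditionalGmgf hm hΔ0 hΔ1 n _ hκm hκ, mul_left_comm, Finset.mul_sum]
  push_cast
  congr 1
  exact Finset.sum_congr rfl fun l _ => by ring

/-- The mean is the case `n = 1`, `s = 0`: the terms `l = 0, 1` contribute `1` and `K`, since `c`
averages to `1`. -/
theorem integral_channelPower (hm : 0 < m) (hv : v ≠ 0) (hK0 : 0 ≤ K)
    (hK : K * (2 * v) = V₁ ^ 2 + V₂ ^ 2)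
    (hΔ0 : 0 ≤ Δ) (hΔ1 : Δ ≤ 1) (hΔ : Δ * (V₁ ^ 2 + V₂ ^ 2) = 2 * V₁ * V₂) :
    ∫ p, channelPower V₁ V₂ p ∂(channelMeasure m v) = 2 * v * (1 + K) := by
  have h := integral_pow_mul_cexp_channelPower hm hv hK0 hK hΔ0 hΔ1 hΔ 1 (s := 0) (by simpa using hm)
  have hmC : (m : ℂ) ≠ 0 := by exact_mod_cast hm.ne'
  have hpi : (Real.pi : ℂ) ≠ 0 := by exact_mod_cast Real.pi_ne_zero
  have hmm : (m : ℂ) ^ (m : ℂ) ≠ 0 := by simp [Complex.cpow_eq_zero_iff, hmC]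
  simp only [zero_mul, mul_zero, Complex.exp_zero, mul_one, pow_one, sub_zero, inv_one, sub_self,
    one_pow, Finset.sum_range_succ, Finset.sum_range_zero, pow_zero, zero_add, one_mul] at h
  rw [integral_complex_ofReal, intervalIntegral.integral_const, intervalIntegral.integral_mul_const,
    intervalIntegral.integral_ofReal, integral_one_add_mul_two_sin_sq_sub_one,
    Complex.ofReal_cpow hm.le, Complex.cpow_neg, Complex.cpow_neg, Nat.cast_one,
    Nat.cast_zero, add_zero, Complex.cpow_add _ _ hmC, Complex.cpow_one] at h
  simp only [Nat.factorial_one, Nat.factorial_zero, Nat.choose_self, Nat.choose_zero_right,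
    Nat.cast_one, ascPochhammer_zero, ascPochhammer_one, Polynomial.eval_one, Polynomial.eval_X,
    Complex.real_smul, sub_zero] at h
  rw [← Complex.ofReal_inj, h]
  push_cast
  field_simp

theorem pos_sub_add_mul {γbar c x : ℝ} (hm : 0 < m) (hK0 : 0 ≤ K) (hγ : 0 < γbar)
    (hs : (m + K + K * Δ) * γbar * x < m * (1 + K)) (hc0 : 0 ≤ c) (hc1 : c ≤ 1 + Δ) :
    0 < m * (1 + K) - (m + K * c) * γbar * x := by
  rcases le_or_gt x 0 with hx | hx
  · have : (m + K * c) * γbar * x ≤ 0 := mul_nonpos_of_nonneg_of_nonpos (by positivity) hx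
    have : 0 < m * (1 + K) := by positivity
    linarith
  · have : (m + K * c) * γbar * x ≤ (m + K + K * Δ) * γbar * x := by
      rw [add_assoc m K, ← mul_one_add]
      gcongr
    linarith

/-- Let `E(c) = m(1+K) - (m+Kc) γbar s`, `F = 1 + K - γbar s` and `D = E(1-Δ)`. Then `m - κ = E/F`
and `1 - z sin² θ = E/D`. All three have positive real part, so the principal powers split. -/
theorem integral_specular_average {γbar : ℝ} (hm : 0 < m) (hK0 : 0 ≤ K) (hγ : 0 < γbar)
    (hΔ0 : 0 ≤ Δ) (hΔ1 : Δ ≤ 1) {s : ℂ} (hs : (m + K + K * Δ) * γbar * s.re < m * (1 + K))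
    (l : ℕ) (hF : 0 < (1 + K - γbar * s : ℂ).re) :
    (Real.pi : ℂ)⁻¹ * ∫ θ in (0 : ℝ)..Real.pi,
        ((1 + Δ * (2 * Real.sin θ ^ 2 - 1) : ℝ) : ℂ) ^ l *
        (m - K * ((1 + Δ * (2 * Real.sin θ ^ 2 - 1) : ℝ) : ℂ) * (γbar * s / (1 + K - γbar * s)))
          ^ (-(m + l : ℂ))
      = (1 + K - γbar * s : ℂ) ^ (m + l : ℂ)
        / (m * (1 + K) - (m + K - K * Δ) * γbar * s : ℂ) ^ (m + l : ℂ)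
        * ∑ q ∈ Finset.range (l + 1), (l.choose q : ℂ) * (1 - Δ : ℂ) ^ (l - q) * (2 * Δ : ℂ) ^ q
          * (wallisRatio q : ℂ) * gaussHypergeometric (m + l) (1 / 2 + q) (q + 1)
              (2 * K * Δ * γbar * s / (m * (1 + K) - (m + K - K * Δ) * γbar * s)) := by
  set F : ℂ := 1 + K - γbar * s with hFdef
  set D : ℂ := m * (1 + K) - (m + K - K * Δ) * γbar * s with hDdef
  set z : ℂ := 2 * K * Δ * γbar * s / D with hz
  have hre : ∀ c : ℝ, 0 ≤ c → c ≤ 1 + Δ →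
      0 < (m * (1 + K) - (m + K * c) * γbar * s : ℂ).re := fun c h0 h1 => by
    have : (m * (1 + K) - (m + K * c) * γbar * s : ℂ)
        = ((m * (1 + K) : ℝ) : ℂ) - (((m + K * c) * γbar : ℝ) : ℂ) * s := by push_cast; ring
    rw [this, Complex.sub_re, Complex.re_ofReal_mul, Complex.ofReal_re]
    exact pos_sub_add_mul hm hK0 hγ hs h0 h1
  have hD : 0 < D.re := by
    convert hre (1 - Δ) (by linarith) (by linarith) using 2
    rw [hDdef]; push_cast; ring
  have hD0 : D ≠ 0 := fun h => by simp [h] at hD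
  have hF0 : F ≠ 0 := fun h => by simp [h] at hF
  -- `1 - z` is the quotient `E/D` at the extreme value `c = 1 + Δ`.
  have hzs : 1 - z ∈ Complex.slitPlane := by
    have : 1 - z = (m * (1 + K) - (m + K * (1 + Δ : ℝ)) * γbar * s : ℂ) / D := by
      rw [hz, eq_div_iff hD0, sub_mul, div_mul_cancel₀ _ hD0, hDdef]; push_cast; ring
    rw [this]
    exact div_mem_slitPlane_of_re_pos (hre _ (by linarith) le_rfl) hD
  have hpt : ∀ θ : ℝ, ((1 + Δ * (2 * Real.sin θ ^ 2 - 1) : ℝ) : ℂ) ^ l *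
        (m - K * ((1 + Δ * (2 * Real.sin θ ^ 2 - 1) : ℝ) : ℂ) * (γbar * s / F)) ^ (-(m + l : ℂ))
      = ∑ q ∈ Finset.range (l + 1), F ^ (m + l : ℂ) / D ^ (m + l : ℂ) *
        ((l.choose q : ℂ) * (1 - Δ : ℂ) ^ (l - q) * (2 * Δ : ℂ) ^ q) *
        (((Real.sin θ ^ 2 : ℝ) : ℂ) ^ q *
          (1 - z * ((Real.sin θ ^ 2 : ℝ) : ℂ)) ^ (-(m + l : ℂ))) := fun θ => by
    obtain ⟨h0, h1⟩ := one_add_mul_cos_mem_Icc hΔ0 hΔ1 (x := 2 * Real.sin θ ^ 2 - 1)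
      ⟨by nlinarith [sq_nonneg (Real.sin θ)], by nlinarith [Real.sin_sq_le_one θ]⟩
    have hE := hre _ h0 h1
    set E : ℂ := m * (1 + K) - (m + K * (1 + Δ * (2 * Real.sin θ ^ 2 - 1) : ℝ)) * γbar * s with hEd
    have e1 : (m - K * ((1 + Δ * (2 * Real.sin θ ^ 2 - 1) : ℝ) : ℂ) * (γbar * s / F) : ℂ) = E / F := by
      rw [eq_div_iff hF0, sub_mul, mul_assoc _ (_ / F), div_mul_cancel₀ _ hF0, hEd, hFdef]; ring
    have e2 : 1 - z * ((Real.sin θ ^ 2 : ℝ) : ℂ) = E / D := by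
      rw [hz, eq_div_iff hD0, sub_mul, mul_right_comm, div_mul_cancel₀ _ hD0, hDdef, hEd]
      push_cast; ring
    have e3 : ((1 + Δ * (2 * Real.sin θ ^ 2 - 1) : ℝ) : ℂ)
        = 2 * Δ * ((Real.sin θ ^ 2 : ℝ) : ℂ) + (1 - Δ) := by push_cast; ring
    rw [e1, e2, e3, div_cpow_of_re_pos hE hF, div_cpow_of_re_pos hE hD, add_pow, Finset.sum_mul]
    refine Finset.sum_congr rfl fun q _ => ?_
    have hDa : D ^ (m + l : ℂ) ≠ 0 := by simp [Complex.cpow_eq_zero_iff, hD0]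
    have hFa : F ^ (m + l : ℂ) ≠ 0 := by simp [Complex.cpow_eq_zero_iff, hF0]
    rw [Complex.cpow_neg D, Complex.cpow_neg F, mul_pow]
    field_simp
  simp_rw [hpt]
  rw [intervalIntegral.integral_finsetSum fun q _ =>
    ((continuous_eulerIntegrand (m + l) q hzs).const_mul _).intervalIntegrable _ _,
    Finset.mul_sum, Finset.mul_sum]
  refine Finset.sum_congr rfl fun q _ => ?_
  rw [intervalIntegral.integral_const_mul, mul_assoc _ (wallisRatio q : ℂ),
    wallisRatio_mul_gaussHypergeometric _ _ hzs, eulerIntegral]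
  ring

theorem gmgf_summand_eq {k F : ℂ} (hk : k ≠ 0) (hF : F ≠ 0) (n l : ℕ)
    (A B C M N P S f g x : ℂ) :
    N * (g / k) ^ n * (k / F) ^ (n + 1) * (C / f * (x * (k / F)) ^ l * (M * P)
        * (A * F ^ (n + 1 + l) / B * S))
      = N * M * A * g ^ n * (C * P / f * (k ^ (l + 1) * x ^ l / B) * S) := by
  rw [div_pow, div_pow, mul_pow, div_pow, pow_add F (n + 1) l, pow_succ k n, pow_succ k l]
  have h1 := pow_ne_zero n hk
  have h2 := pow_ne_zero (n + 1) hF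
  have h3 := pow_ne_zero l hF
  -- `B` and `f` occur only through their inverses, so they need not be nonzero.
  rw [div_eq_mul_inv (_ * _) B, div_eq_mul_inv (_ * _) B]
  generalize B⁻¹ = B
  rw [div_eq_mul_inv _ f, div_eq_mul_inv _ f]
  generalize f⁻¹ = f
  generalize k ^ n = a at h1 ⊢
  generalize F ^ (n + 1) = b at h2 ⊢
  generalize F ^ l = c at h3 ⊢
  generalize k ^ l = d
  generalize g ^ n = y
  generalize x ^ l = z
  field_simp

theorem gmgf_channelPower {γbar : ℝ} (hm : 0 < m) (hv : v ≠ 0) (hK0 : 0 ≤ K)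
    (hK : K * (2 * v) = V₁ ^ 2 + V₂ ^ 2)
    (hΔ0 : 0 ≤ Δ) (hΔ1 : Δ ≤ 1) (hΔ : Δ * (V₁ ^ 2 + V₂ ^ 2) = 2 * V₁ * V₂) (n : ℕ) {s : ℂ}
    (hγbar : γbar = 2 * v * (1 + K)) (hγ0 : 0 < γbar)
    (hs : (m + K + K * Δ) * γbar * s.re < m * (1 + K))
    (hs' : (m + K * (1 + Δ)) * (2 * v * s.re) < m) :
    ∫ p, (channelPower V₁ V₂ p : ℂ) ^ n * Complex.exp (s * channelPower V₁ V₂ p)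
        ∂(channelMeasure m v) =
      (n.factorial : ℂ) * (m : ℂ) ^ (m : ℂ)
        * (1 + K - γbar * s : ℂ) ^ ((m : ℂ) - n - 1) * (γbar : ℂ) ^ n
        * ∑ l ∈ Finset.range (n + 1),
            (n.choose l : ℂ) * (((ascPochhammer ℝ l).eval m : ℝ) : ℂ) / (l.factorial : ℂ)
              * ((1 + K : ℂ) ^ (l + 1) * (K : ℂ) ^ l
                  / (m * (1 + K) - (m + K - K * Δ) * γbar * s : ℂ) ^ ((m : ℂ) + l))
              * ∑ q ∈ Finset.range (l + 1),
                  (l.choose q : ℂ) * (1 - Δ : ℂ) ^ (l - q) * (2 * Δ : ℂ) ^ q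
                    * ((Real.Gamma (1 / 2 + q) / (Real.sqrt Real.pi * Real.Gamma (q + 1)) : ℝ) : ℂ)
                    * gaussHypergeometric (m + l) (1 / 2 + q) (q + 1)
                        (2 * K * Δ * γbar * s
                          / (m * (1 + K) - (m + K - K * Δ) * γbar * s)) := by
  have h1K : (1 + K : ℂ) ≠ 0 := by
    have : (1 + K : ℝ) ≠ 0 := by positivity
    exact_mod_cast this
  have hγC : (γbar : ℂ) = 2 * v * (1 + K) := by rw [hγbar]; push_cast; rfl
  have hFeq : (1 + K - γbar * s : ℂ) = ((1 + K : ℝ) : ℂ) * (1 - 2 * v * s) := by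
    rw [hγC]; push_cast; ring
  have hF : 0 < (1 + K - γbar * s : ℂ).re := by
    have h1 := (exists_bound_re_mul_inv_sub_one (w := 2 * v) (s := s) hm hK0 hΔ0 hs').1
    rw [hFeq, Complex.re_ofReal_mul]
    have : (1 - 2 * v * s : ℂ).re = 1 - 2 * v * s.re := by simp
    rw [this]
    have : 0 < 1 - 2 * v * s.re := by linarith
    positivity
  have hF0 : (1 + K - γbar * s : ℂ) ≠ 0 := fun h => by simp [h] at hF
  have hD0 : (1 - 2 * v * s : ℂ) ≠ 0 := fun h => by rw [hFeq, h, mul_zero] at hF0; exact hF0 rfl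
  have hu : (1 - 2 * v * s : ℂ)⁻¹ = (1 + K) / (1 + K - γbar * s) := by
    rw [hFeq]; push_cast; field_simp
  have hu1 : (1 + K : ℂ) / (1 + K - γbar * s) - 1 = γbar * s / (1 + K - γbar * s) := by
    field_simp
    ring
  have hw : (2 * v : ℂ) = γbar / (1 + K) := by rw [hγC]; field_simp
  rw [integral_pow_mul_cexp_channelPower hm hv hK0 hK hΔ0 hΔ1 hΔ n hs', hu, hu1, hw,
    Finset.mul_sum, Finset.mul_sum]
  refine Finset.sum_congr rfl fun l _ => ?_
  rw [integral_specular_average hm hK0 hγ0 hΔ0 hΔ1 hs l hF, ofReal_ascPochhammer_eval,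
    Complex.ofReal_cpow hm.le]
  simp_rw [wallisRatio_eq_Gamma]
  -- The integer power split off here cancels the `F` in `u ^ (n + 1)` and `uˡ`, where `u = (1 +
  -- K)/F`.
  have hpow : (1 + K - γbar * s : ℂ) ^ (m + l : ℂ)
      = (1 + K - γbar * s : ℂ) ^ ((m : ℂ) - n - 1) * (1 + K - γbar * s : ℂ) ^ (n + 1 + l) := by
    rw [← Complex.cpow_natCast, ← Complex.cpow_add _ _ hF0]
    congr 1
    push_cast
    ring
  rw [hpow]
  exact gmgf_summand_eq h1K hF0 n l _ _ _ _ _ _ _ _ _ _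

end

theorem lemma1 {Ω : Type*} [MeasurableSpace Ω] (P : Measure Ω) (γ : Ω → ℝ)
    (γbar m K Δ : ℝ) (hγ : IsFTR γ γbar m K Δ P) (n : ℕ) (s : ℂ)
    (hs : (m + K + K * Δ) * γbar * s.re < m * (1 + K)) :
    Integrable (fun ω => (γ ω : ℂ) ^ n * Complex.exp (s * γ ω)) P ∧
    gmgf γ P n s =
      (n.factorial : ℂ) * (m : ℂ) ^ (m : ℂ)
        * (1 + K - γbar * s : ℂ) ^ ((m : ℂ) - n - 1) * (γbar : ℂ) ^ n
        * ∑ l ∈ Finset.range (n + 1),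
            (n.choose l : ℂ) * (((ascPochhammer ℝ l).eval m : ℝ) : ℂ) / (l.factorial : ℂ)
              * ((1 + K : ℂ) ^ (l + 1) * (K : ℂ) ^ l
                  / (m * (1 + K) - (m + K - K * Δ) * γbar * s : ℂ) ^ ((m : ℂ) + l))
              * ∑ q ∈ Finset.range (l + 1),
                  (l.choose q : ℂ) * (1 - Δ : ℂ) ^ (l - q) * (2 * Δ : ℂ) ^ q
                    * ((Real.Gamma (1 / 2 + q) / (Real.sqrt Real.pi * Real.Gamma (q + 1)) : ℝ) : ℂ)
                    * gaussHypergeometric (m + l) (1 / 2 + q) (q + 1)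
                        (2 * K * Δ * γbar * s
                          / (m * (1 + K) - (m + K - K * Δ) * γbar * s)) := by
  obtain ⟨hm, hΔ0, hΔ1, V₁, V₂, σ, -, -, hσ, hKdef, hΔ, hmean, hlaw⟩ := hγ
  set v : NNReal := (σ ^ 2).toNNReal with hvdef
  have hvσ : (v : ℝ) = σ ^ 2 := Real.coe_toNNReal _ (sq_nonneg σ)
  have hv : v ≠ 0 := by
    intro h
    rw [h] at hvσ
    have : 0 < σ ^ 2 := by positivity
    simp at hvσ
    exact this.ne hvσ
  have hv0 : (0 : ℝ) < v := by positivity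
  have hK0 : 0 ≤ K := by rw [hKdef]; positivity
  have hK : K * (2 * v) = V₁ ^ 2 + V₂ ^ 2 := by rw [hvσ, hKdef]; field_simp
  have hmeas : Measurable (channelPower V₁ V₂) := (continuous_channelPower V₁ V₂).measurable
  have hlaw' : envelopePowerLaw m V₁ V₂ σ = (channelMeasure m v).map (channelPower V₁ V₂) := rfl
  have hγbar : γbar = 2 * v * (1 + K) := by
    rw [hmean, hlaw']
    refine (integral_map hmeas.aemeasurable aestronglyMeasurable_id).trans ?_
    exact integral_channelPower hm hv hK0 hK hΔ0 hΔ1 hΔ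
  have hγ0 : 0 < γbar := by rw [hγbar]; positivity
  -- Dividing `hs` by `1 + K > 0` removes the mean, since `γbar = 2v(1 + K)`.
  have hs' : (m + K * (1 + Δ)) * (2 * v * s.re) < m := by
    rw [hγbar] at hs
    refine lt_of_mul_lt_mul_right (a := 1 + K) ?_ (by positivity)
    linarith
  have hcont : Continuous (fun x : ℝ => (x : ℂ) ^ n * Complex.exp (s * x)) := by fun_prop
  have hγmap : P.map γ = (channelMeasure m v).map (channelPower V₁ V₂) := hlaw.map_eq
  constructor
  · have h1 : Integrable (fun x : ℝ => (x : ℂ) ^ n * Complex.exp (s * x)) (P.map γ) := by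
      rw [hγmap, integrable_map_measure hcont.aestronglyMeasurable hmeas.aemeasurable]
      exact integrable_pow_mul_cexp_channelPower hm hv hK0 hK hΔ0 hΔ1 hΔ n hs'
    exact h1.comp_aemeasurable hlaw.aemeasurable
  have h2 : gmgf γ P n s = ∫ p, (channelPower V₁ V₂ p : ℂ) ^ n *
      Complex.exp (s * channelPower V₁ V₂ p) ∂(channelMeasure m v) := by
    rw [gmgf, ← integral_map (f := fun x : ℝ => (x : ℂ) ^ n * Complex.exp (s * x))
      hlaw.aemeasurable hcont.aestronglyMeasurable, hγmap,
      integral_map hmeas.aemeasurable hcont.aestronglyMeasurable]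
  exact h2.trans (gmgf_channelPower hm hv hK0 hK hΔ0 hΔ1 hΔ n hγbar hγ0 hs hs')
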